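/- Let $\Omega\subset\mathbb R^N$ be a bounded open set, let $\gamma_0,\gamma_1>0$ be constants with $\gamma_0\neq\gamma_1$, and let $\omega_n\subset\Omega$ $(n\in\mathbb N)$ be measurable sets with $|x-y|\ge d_0$ for all $x\in\omega_n$, $y\in\partial\Omega$, with a constant $d_0>0$ independent of $n$, and with $|\omega_n|\to\delta>0$. Put $\gamma_n=\gamma_1\chi_{\omega_n}+\gamma_0(1-\chi_{\omega_n})$. Assume that $\chi_{\omega_n}\rightharpoonup\theta$ weakly-* in $L^\infty(\Omega;[0,1])$ and that $\gamma_n I$ H-converges in $\Omega$ to a measurable symmetric matrix field $\gamma^*$ with $\min\{\gamma_0,\gamma_1\}I\le\gamma^*\le\max\{\gamma_0,\gamma_1\}I$ a.e. in $\Omega$; H-convergence means that for every $g\in H^{-1}(\Omega)$ the solutions $u_n,u\in H^1_0(\Omega)$ of $-\nabla\cdot(\gamma_n\nabla u_n)=g$ and $-\nabla\cdot(\gamma^*\nabla u)=g$ satisfy $u_n\rightharpoonup u$ weakly in $H^1(\Omega)$ and $\gamma_n\nabla u_n\rightharpoonup\gamma^*\nabla u$ weakly in $L^2(\Omega)^N$.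 For $1\le i\le N$ let $w_n^i\in H^1(\Omega)$ be the corrector, that is, the weak solution of $$-\nabla\cdot(\gamma_n\nabla w_n^i)=-\nabla\cdot(\gamma^*e_i)\ \text{ in }\Omega,\qquad w_n^i-x_i\in H^1_0(\Omega).$$ Let $\mu^\theta$ be a finite positive Borel measure on $\overline\Omega$ and let $M^\theta=(M^\theta_{ij})$ be a matrix-valued function in $L^2(\mu^\theta)$ (the polarization tensor) such that, along some subsequence, $$\frac{1}{|\omega_n|}\chi_{\omega_n}\,dx\overset{*}{\rightharpoonup}\mu^\theta,\qquad \frac{1}{|\omega_n|}\chi_{\omega_n}\frac{\partial w_n^i}{\partial x_j}\,dx\overset{*}{\rightharpoonup}M^\theta_{ij}\,\mu^\theta\quad(1\le i,j\le N)\qquad\text{in }(C^0(\overline\Omega))^*.$$ Then for $\mu^\theta$-almost every $x$ and all $\xi\in\mathbb R^N$, $$\min\Big\{1,\frac{\gamma_0}{\theta(x)\gamma_0+(1-\theta(x))\gamma_1}\Big\}|\xi|^2\le\sum_{i,j=1}^N M^\theta_{ij}(x)\xi_i\xi_j\le\max\Big\{1,\frac{\gamma_0}{\theta(x)\gamma_0+(1-\theta(x))\gamma_1}\Big\}|\xi|^2.$$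 -/

import Mathlib

open MeasureTheory Filter Topology

/-- `φ ∈ C_c^∞(Ω)`. -/
def IsTestFunction {N : ℕ} (Ω : Set (EuclideanSpace ℝ (Fin N)))
    (φ : EuclideanSpace ℝ (Fin N) → ℝ) : Prop :=
  ContDiff ℝ ((⊤ : ℕ∞) : WithTop ℕ∞) φ ∧ HasCompactSupport φ ∧ tsupport φ ⊆ Ω

/-- `u ∈ H¹₀(Ω)` with weak gradient `G`: the pair `(u, G)` lies in the closure of
`{(φ, ∇φ) | φ ∈ C_c^∞(Ω)}` in `L²(Ω) × L²(Ω; ℝ^N)`. -/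
def MemH10 {N : ℕ} (Ω : Set (EuclideanSpace ℝ (Fin N)))
    (u : EuclideanSpace ℝ (Fin N) → ℝ)
    (G : EuclideanSpace ℝ (Fin N) → EuclideanSpace ℝ (Fin N)) : Prop :=
  MemLp u 2 (volume.restrict Ω) ∧ MemLp G 2 (volume.restrict Ω) ∧
    ∃ φ : ℕ → EuclideanSpace ℝ (Fin N) → ℝ, (∀ n, IsTestFunction Ω (φ n)) ∧
      Tendsto (fun n => eLpNorm (fun x => u x - φ n x) 2 (volume.restrict Ω)) atTop (𝓝 0) ∧
      Tendsto (fun n => eLpNorm (fun x => G x - gradient (φ n) x) 2 (volume.restrict Ω))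
        atTop (𝓝 0)

/-- The vector field `x ↦ A(x) G(x)`. -/
noncomputable def flux {N : ℕ}
    (A : EuclideanSpace ℝ (Fin N) → Matrix (Fin N) (Fin N) ℝ)
    (G : EuclideanSpace ℝ (Fin N) → EuclideanSpace ℝ (Fin N))
    (x : EuclideanSpace ℝ (Fin N)) : EuclideanSpace ℝ (Fin N) :=
  WithLp.toLp 2 (fun i => ∑ j, A x i j * G x j)

/-- For `G = ∇u`, the equation `-div (A ∇u) = -div F` in `Ω`, in the weak sense. -/
def SolvesWeakly {N : ℕ} (Ω : Set (EuclideanSpace ℝ (Fin N)))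
    (A : EuclideanSpace ℝ (Fin N) → Matrix (Fin N) (Fin N) ℝ)
    (G F : EuclideanSpace ℝ (Fin N) → EuclideanSpace ℝ (Fin N)) : Prop :=
  ∀ φ : EuclideanSpace ℝ (Fin N) → ℝ, IsTestFunction Ω φ →
    ∫ x in Ω, inner ℝ (flux A G x) (gradient φ x) = ∫ x in Ω, inner ℝ (F x) (gradient φ x)

/-- Weak convergence `f n ⇀ g` in `L²(Ω; V)` (for `L²` functions `f n` and `g`). -/
def WeakTendstoL2 {N : ℕ} {V : Type*} [NormedAddCommGroup V] [InnerProductSpace ℝ V]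
    (Ω : Set (EuclideanSpace ℝ (Fin N)))
    (f : ℕ → EuclideanSpace ℝ (Fin N) → V) (g : EuclideanSpace ℝ (Fin N) → V) : Prop :=
  ∀ ψ : EuclideanSpace ℝ (Fin N) → V, MemLp ψ 2 (volume.restrict Ω) →
    Tendsto (fun n => ∫ x in Ω, inner ℝ (f n x) (ψ x)) atTop
      (𝓝 (∫ x in Ω, inner ℝ (g x) (ψ x)))

/-- H-convergence (Murat, Tartar) of `A n` to `B` in `Ω`: for every right-hand side in
`H⁻¹(Ω)`, that is, of the form `-div F` with `F ∈ L²(Ω; ℝ^N)`, the solutions `u n ∈ H¹₀(Ω)` of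
`-div (A n ∇(u n)) = -div F` and the solution `v ∈ H¹₀(Ω)` of `-div (B ∇v) = -div F` satisfy
`u n ⇀ v` weakly in `H¹(Ω)` and `A n ∇(u n) ⇀ B ∇v` weakly in `L²(Ω; ℝ^N)`. -/
def HConverges {N : ℕ} (Ω : Set (EuclideanSpace ℝ (Fin N)))
    (A : ℕ → EuclideanSpace ℝ (Fin N) → Matrix (Fin N) (Fin N) ℝ)
    (B : EuclideanSpace ℝ (Fin N) → Matrix (Fin N) (Fin N) ℝ) : Prop :=
  ∀ F : EuclideanSpace ℝ (Fin N) → EuclideanSpace ℝ (Fin N),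
    MemLp F 2 (volume.restrict Ω) →
  ∀ (u : ℕ → EuclideanSpace ℝ (Fin N) → ℝ)
    (G : ℕ → EuclideanSpace ℝ (Fin N) → EuclideanSpace ℝ (Fin N))
    (v : EuclideanSpace ℝ (Fin N) → ℝ)
    (H : EuclideanSpace ℝ (Fin N) → EuclideanSpace ℝ (Fin N)),
    (∀ n, MemH10 Ω (u n) (G n) ∧ SolvesWeakly Ω (A n) (G n) F) →
    MemH10 Ω v H → SolvesWeakly Ω B H F →
      WeakTendstoL2 Ω u v ∧ WeakTendstoL2 Ω G H ∧
        WeakTendstoL2 Ω (fun n => flux (A n) (G n)) (flux B H)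

/-- The two-phase conductivity `γ₁ χ_ω + γ₀ (1 - χ_ω)`, times the identity matrix. -/
noncomputable def twoPhase {N : ℕ} (γ₀ γ₁ : ℝ) (ω : Set (EuclideanSpace ℝ (Fin N)))
    (x : EuclideanSpace ℝ (Fin N)) : Matrix (Fin N) (Fin N) ℝ :=
  (γ₁ * ω.indicator 1 x + γ₀ * (1 - ω.indicator 1 x)) • (1 : Matrix (Fin N) (Fin N) ℝ)

/-- A measurable field `B` of symmetric matrices on `Ω` with `a I ≤ B ≤ b I` almost everywhere. -/
def IsConductivity {N : ℕ} (a b : ℝ) (Ω : Set (EuclideanSpace ℝ (Fin N)))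
    (B : EuclideanSpace ℝ (Fin N) → Matrix (Fin N) (Fin N) ℝ) : Prop :=
  (∀ i j, AEStronglyMeasurable (fun x => B x i j) (volume.restrict Ω)) ∧
  ∀ᵐ x ∂(volume.restrict Ω), (B x).IsSymm ∧ ∀ ξ : EuclideanSpace ℝ (Fin N),
    a * ‖ξ‖ ^ 2 ≤ ∑ i, ∑ j, B x i j * ξ i * ξ j ∧
    ∑ i, ∑ j, B x i j * ξ i * ξ j ≤ b * ‖ξ‖ ^ 2

/-- Weak-* convergence `χ_(ω n) ⇀ θ` in `L^∞(Ω; [0, 1])`. -/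
def IsVolumeFraction {N : ℕ} (Ω : Set (EuclideanSpace ℝ (Fin N)))
    (ω : ℕ → Set (EuclideanSpace ℝ (Fin N))) (θ : EuclideanSpace ℝ (Fin N) → ℝ) : Prop :=
  AEStronglyMeasurable θ (volume.restrict Ω) ∧
  (∀ᵐ x ∂(volume.restrict Ω), θ x ∈ Set.Icc (0 : ℝ) 1) ∧
  ∀ ψ : EuclideanSpace ℝ (Fin N) → ℝ, Integrable ψ (volume.restrict Ω) →
    Tendsto (fun n => ∫ x in Ω, (ω n).indicator 1 x * ψ x) atTop (𝓝 (∫ x in Ω, θ x * ψ x))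

/-- `w i`, with gradient `W i`, is the solution of `-div (A ∇(w i)) = -div (B e_i)` in `Ω`,
`w i = x_i` on `∂Ω`, for every `i`. -/
def IsCorrector {N : ℕ} (Ω : Set (EuclideanSpace ℝ (Fin N)))
    (A B : EuclideanSpace ℝ (Fin N) → Matrix (Fin N) (Fin N) ℝ)
    (w : Fin N → EuclideanSpace ℝ (Fin N) → ℝ)
    (W : Fin N → EuclideanSpace ℝ (Fin N) → EuclideanSpace ℝ (Fin N)) : Prop :=
  ∀ i, MemH10 Ω (fun x => w i x - x i) (fun x => W i x - EuclideanSpace.single i 1) ∧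
    SolvesWeakly Ω A (W i) (flux B (fun _ => EuclideanSpace.single i 1))

/-- Weak-* convergence in `C⁰(closure Ω)*` of `|ω n|⁻¹ χ_(ω n) f n dx` to `g dμ`, for sets
`ω n ⊆ Ω` and a measure `μ` concentrated on `closure Ω`. Elements of `C⁰(closure Ω)` are
restrictions of continuous functions on the whole space, as `closure Ω` is closed. -/
def WeakStarTendsto {N : ℕ} (ω : ℕ → Set (EuclideanSpace ℝ (Fin N)))
    (f : ℕ → EuclideanSpace ℝ (Fin N) → ℝ)
    (g : EuclideanSpace ℝ (Fin N) → ℝ) (μ : Measure (EuclideanSpace ℝ (Fin N))) : Prop :=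
  ∀ φ : EuclideanSpace ℝ (Fin N) → ℝ, Continuous φ →
    Tendsto (fun n => (volume.real (ω n))⁻¹ * ∫ x in ω n, f n x * φ x) atTop
      (𝓝 (∫ x, g x * φ x ∂μ))

/-- `M ∈ L²(Ω, dμ)` is a polarization tensor, with associated positive finite Borel measure `μ`
on `closure Ω`, of the inhomogeneities `ω n` with homogenized tensor `B`: for some subsequence,
`|ω n|⁻¹ χ_(ω n) dx ⇀ dμ` and `|ω n|⁻¹ χ_(ω n) ∂_j (w n i) dx ⇀ M_ij dμ` weakly-* in
`C⁰(closure Ω)*`, where the `w n i` are the correctors. -/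
def IsPolarizationTensor {N : ℕ} (Ω : Set (EuclideanSpace ℝ (Fin N))) (γ₀ γ₁ : ℝ)
    (ω : ℕ → Set (EuclideanSpace ℝ (Fin N)))
    (B : EuclideanSpace ℝ (Fin N) → Matrix (Fin N) (Fin N) ℝ)
    (μ : Measure (EuclideanSpace ℝ (Fin N)))
    (M : EuclideanSpace ℝ (Fin N) → Matrix (Fin N) (Fin N) ℝ) : Prop :=
  IsFiniteMeasure μ ∧ μ (closure Ω)ᶜ = 0 ∧ (∀ i j, MemLp (fun x => M x i j) 2 μ) ∧
  ∃ (w : ℕ → Fin N → EuclideanSpace ℝ (Fin N) → ℝ)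
    (W : ℕ → Fin N → EuclideanSpace ℝ (Fin N) → EuclideanSpace ℝ (Fin N)) (σ : ℕ → ℕ),
    (∀ n, IsCorrector Ω (twoPhase γ₀ γ₁ (ω n)) B (w n) (W n)) ∧ StrictMono σ ∧
    WeakStarTendsto (fun k => ω (σ k)) (fun _ _ => 1) (fun _ => 1) μ ∧
    ∀ i j, WeakStarTendsto (fun k => ω (σ k)) (fun k x => W (σ k) i x j) (fun x => M x i j) μ

/-! The weak solutions oscillate together with the phases, but the fields `γ_n ∇w` and `∇w` have
controlled divergence and curl, and products of such fields pass to the limit. Fix a direction `ξ`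
and let `X n` be the gradient of the corrector with affine boundary values `⟨ξ, x⟩`.

* `X n ⇀ ξ` weakly in `L²` (`IsCorrectorAlong.weakTendsto`): as the coefficients are symmetric,
  `∫ ⟨X n - ξ, F⟩` is expressed through the solution with right-hand side `F`, to which
  H-convergence applies. By Rellich's theorem, the correctors themselves converge strongly.
* `γ_n X n → γ* ξ` in the sense of distributions (`IsCorrectorAlong.tendsto_integral_flux`): the
  limit of `γ_n X n · ∇u n`, where `u n` converges to a given test function and has the
  right-hand side of its limit, is computed twice by the div-curl lemma
  `tendsto_integral_div_curl`, with either factor as the gradient.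
* `γ_n |X n|² → ⟨γ* ξ, ξ⟩` in the sense of distributions
  (`IsCorrectorAlong.tendsto_integral_energy`), again by the div-curl lemma.

Passing to the limit in `γ_n |X n - ξ|² ≥ 0` and in `γ_n⁻¹ |γ_n X n - t ξ|² ≥ 0` bounds `γ*` by the
arithmetic and the harmonic mean of the phases. On the other hand, `μ = (θ / δ) dx`, and
`(γ₁ - γ₀) χ_(ω n) X n = γ_n X n - γ₀ X n` yields `(γ₁ - γ₀) θ ⟨M ξ, ξ⟩ = ⟨γ* ξ, ξ⟩ - γ₀ |ξ|²`
(`ae_polarization_eq`). Dividing the bounds on `γ*` by `(γ₁ - γ₀) θ`, which is nonzero `μ`-almost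
everywhere, gives the claim.

Solutions with arbitrary right-hand sides are provided by the Lax–Milgram theorem in `H¹₀(Ω)`. The
Poincaré inequality and Rellich's theorem are both obtained from the Fourier transform of test
functions: high frequencies are controlled by the gradient, low frequencies by the boundedness of
`Ω`. -/

/-! ### Pairings in `L²` -/

section L2
variable {α : Type*} [MeasurableSpace α] {μ : Measure α}
  {V : Type*} [NormedAddCommGroup V] [InnerProductSpace ℝ V]

theorem inner_toLp_toLp {f g : α → V} (hf : MemLp f 2 μ) (hg : MemLp g 2 μ) :
    inner ℝ (hf.toLp f) (hg.toLp g) = ∫ x, inner ℝ (f x) (g x) ∂μ := by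
  rw [L2.inner_def]
  apply integral_congr_ae
  filter_upwards [hf.coeFn_toLp, hg.coeFn_toLp] with x h1 h2
  rw [h1, h2]

theorem integrable_inner_of_memLp {f g : α → V} (hf : MemLp f 2 μ) (hg : MemLp g 2 μ) :
    Integrable (fun x => inner ℝ (f x) (g x)) μ := by
  refine (L2.integrable_inner (𝕜 := ℝ) (hf.toLp f) (hg.toLp g)).congr ?_
  filter_upwards [hf.coeFn_toLp, hg.coeFn_toLp] with x h1 h2
  rw [h1, h2]

theorem abs_integral_inner_le {f g : α → V} (hf : MemLp f 2 μ) (hg : MemLp g 2 μ) :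
    |∫ x, inner ℝ (f x) (g x) ∂μ| ≤ (eLpNorm f 2 μ).toReal * (eLpNorm g 2 μ).toReal := by
  rw [← inner_toLp_toLp hf hg, ← Lp.norm_toLp f hf, ← Lp.norm_toLp g hg]
  exact abs_real_inner_le_norm _ _

theorem integral_norm_sq_eq {f : α → V} (hf : MemLp f 2 μ) :
    ∫ x, ‖f x‖ ^ 2 ∂μ = (eLpNorm f 2 μ).toReal ^ 2 := by
  rw [← Lp.norm_toLp f hf, ← real_inner_self_eq_norm_sq, inner_toLp_toLp]
  simp

/-- A weakly convergent sequence in `L²` is bounded (Banach–Steinhaus). -/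
theorem exists_eLpNorm_le_of_weak [CompleteSpace V] {f : ℕ → α → V} {g : α → V}
    (hf : ∀ n, MemLp (f n) 2 μ)
    (h : ∀ ψ : α → V, MemLp ψ 2 μ → Tendsto (fun n => ∫ x, inner ℝ (f n x) (ψ x) ∂μ) atTop
      (𝓝 (∫ x, inner ℝ (g x) (ψ x) ∂μ))) :
    ∃ C : ℝ, 0 ≤ C ∧ ∀ n, (eLpNorm (f n) 2 μ).toReal ≤ C := by
  obtain ⟨C, hC⟩ := banach_steinhaus (g := fun n => innerSL ℝ ((hf n).toLp (f n))) (by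
    intro ψ
    have := (h ψ (Lp.memLp ψ)).norm.bddAbove_range
    obtain ⟨C, hC⟩ := this
    refine ⟨C, fun n => ?_⟩
    refine le_trans (le_of_eq ?_) (hC ⟨n, rfl⟩)
    simp only [innerSL_apply_apply]
    conv_lhs => rw [← Lp.toLp_coeFn ψ (Lp.memLp ψ)]
    rw [inner_toLp_toLp])
  refine ⟨C, (norm_nonneg _).trans (hC 0), fun n => ?_⟩
  rw [← Lp.norm_toLp (f n) (hf n)]
  simpa using hC n

/-- The pairing of a bounded sequence with a sequence tending to zero strongly in `L²`. -/
theorem tendsto_integral_inner_zero {f g : ℕ → α → V}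
    (hf : ∀ n, MemLp (f n) 2 μ) (hg : ∀ n, MemLp (g n) 2 μ) {C : ℝ}
    (hC : ∀ n, (eLpNorm (f n) 2 μ).toReal ≤ C)
    (hg0 : Tendsto (fun n => (eLpNorm (g n) 2 μ).toReal) atTop (𝓝 0)) :
    Tendsto (fun n => ∫ x, inner ℝ (f n x) (g n x) ∂μ) atTop (𝓝 0) := by
  refine squeeze_zero_norm (a := fun n => C * (eLpNorm (g n) 2 μ).toReal) (fun n => ?_) ?_
  · exact (abs_integral_inner_le (hf n) (hg n)).trans
      (mul_le_mul_of_nonneg_right (hC n) ENNReal.toReal_nonneg)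
  · simpa using hg0.const_mul C

theorem memLp_two_mul_of_bound {f : α → ℝ} {g : α → V}
    (hf : AEStronglyMeasurable f μ) {C : ℝ} (hC : ∀ᵐ x ∂μ, ‖f x‖ ≤ C) (hg : MemLp g 2 μ) :
    MemLp (fun x => f x • g x) 2 μ := by
  have h1 : MemLp f ⊤ μ := memLp_top_of_bound hf C hC
  exact hg.smul h1

theorem eLpNorm_smul_le_of_bound {f : α → ℝ} {g : α → V} {C : ℝ} (hC : ∀ᵐ x ∂μ, ‖f x‖ ≤ C)
    (hg : MemLp g 2 μ) :
    (eLpNorm (fun x => f x • g x) 2 μ).toReal ≤ C * (eLpNorm g 2 μ).toReal := by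
  by_cases hμ : μ = 0
  · simp [hμ]
  have hC0 : 0 ≤ C := by
    have : NeZero μ := ⟨hμ⟩
    obtain ⟨x, hx⟩ := hC.exists
    exact (norm_nonneg _).trans hx
  have h := eLpNorm_le_mul_eLpNorm_of_ae_le_mul (f := fun x => f x • g x) (g := g) (c := C) (μ := μ)
    (by filter_upwards [hC] with x hx
        rw [norm_smul]; gcongr) 2
  have h2 := ENNReal.toReal_mono (ENNReal.mul_ne_top ENNReal.ofReal_ne_top hg.eLpNorm_ne_top) h
  rwa [ENNReal.toReal_mul, ENNReal.toReal_ofReal hC0] at h2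

theorem memLp_smul_of_norm_le {f : α → ℝ} {g : α → V} (hf : MemLp f 2 μ)
    (hg : AEStronglyMeasurable g μ) {C : ℝ} (hC : ∀ x, ‖g x‖ ≤ C) :
    MemLp (fun x => f x • g x) 2 μ := by
  refine hf.of_le_mul (c := C) (hf.1.smul hg) (ae_of_all _ fun x => ?_)
  rw [norm_smul, mul_comm]
  exact mul_le_mul_of_nonneg_right (hC x) (norm_nonneg _)

theorem tendsto_eLpNorm_smul_zero {f : ℕ → α → ℝ} {g : α → V} (hf : ∀ n, MemLp (f n) 2 μ)
    {C : ℝ} (hC0 : 0 ≤ C) (hC : ∀ x, ‖g x‖ ≤ C)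
    (h : Tendsto (fun n => (eLpNorm (f n) 2 μ).toReal) atTop (𝓝 0)) :
    Tendsto (fun n => (eLpNorm (fun x => f n x • g x) 2 μ).toReal) atTop (𝓝 0) := by
  refine squeeze_zero (fun _ => ENNReal.toReal_nonneg) (fun n => ?_) (by simpa using h.const_mul C)
  have h1 := eLpNorm_le_mul_eLpNorm_of_ae_le_mul (f := fun x => f n x • g x) (g := f n) (c := C)
    (μ := μ) (ae_of_all _ fun x => by
      rw [norm_smul, mul_comm]
      exact mul_le_mul_of_nonneg_right (hC x) (norm_nonneg _)) 2
  have h2 := ENNReal.toReal_mono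
    (ENNReal.mul_ne_top ENNReal.ofReal_ne_top (hf n).eLpNorm_ne_top) h1
  rwa [ENNReal.toReal_mul, ENNReal.toReal_ofReal hC0] at h2

end L2

/-! ### Test functions -/

section TestFunctions
variable {N : ℕ} {Ω : Set (EuclideanSpace ℝ (Fin N))}

theorem gradient_apply_eq_fderiv (f : EuclideanSpace ℝ (Fin N) → ℝ)
    (x : EuclideanSpace ℝ (Fin N)) (j : Fin N) :
    gradient f x j = fderiv ℝ f x (EuclideanSpace.single j 1) := by
  rw [← inner_gradient_left, EuclideanSpace.inner_single_right]
  simp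

theorem gradient_mul {f g : EuclideanSpace ℝ (Fin N) → ℝ} {x : EuclideanSpace ℝ (Fin N)}
    (hf : DifferentiableAt ℝ f x) (hg : DifferentiableAt ℝ g x) :
    gradient (fun y => f y * g y) x = f x • gradient g x + g x • gradient f x := by
  simp only [gradient]
  rw [fderiv_fun_mul hf hg]
  simp

theorem gradient_fun_add {f g : EuclideanSpace ℝ (Fin N) → ℝ} {x : EuclideanSpace ℝ (Fin N)}
    (hf : DifferentiableAt ℝ f x) (hg : DifferentiableAt ℝ g x) :
    gradient (fun y => f y + g y) x = gradient f x + gradient g x := by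
  simp only [gradient]
  rw [fderiv_fun_add hf hg]
  simp

theorem gradient_const_mul {f : EuclideanSpace ℝ (Fin N) → ℝ} {x : EuclideanSpace ℝ (Fin N)}
    (c : ℝ) (hf : DifferentiableAt ℝ f x) :
    gradient (fun y => c * f y) x = c • gradient f x := by
  simp only [gradient]
  rw [fderiv_const_mul hf]
  simp

theorem gradient_inner_const (ξ x : EuclideanSpace ℝ (Fin N)) :
    gradient (fun y : EuclideanSpace ℝ (Fin N) => inner ℝ ξ y) x = ξ := by
  have : (fun y : EuclideanSpace ℝ (Fin N) => inner ℝ ξ y) = innerSL ℝ ξ := rfl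
  simp only [gradient]
  rw [this, ContinuousLinearMap.fderiv]
  exact (InnerProductSpace.toDual ℝ _).symm_apply_apply ξ

theorem contDiff_gradient {f : EuclideanSpace ℝ (Fin N) → ℝ}
    (hf : ContDiff ℝ ((⊤ : ℕ∞) : WithTop ℕ∞) f) :
    ContDiff ℝ ((⊤ : ℕ∞) : WithTop ℕ∞) (gradient f) := by
  have h : ContDiff ℝ ((⊤ : ℕ∞) : WithTop ℕ∞) (fderiv ℝ f) := hf.fderiv_right (by simp)
  exact (InnerProductSpace.toDual ℝ (EuclideanSpace ℝ (Fin N))).symm.contDiff.comp h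

namespace IsTestFunction

theorem differentiable {φ : EuclideanSpace ℝ (Fin N) → ℝ} (h : IsTestFunction Ω φ) :
    Differentiable ℝ φ := h.1.differentiable (by simp)

theorem mul_contDiff {φ ψ : EuclideanSpace ℝ (Fin N) → ℝ} (h : IsTestFunction Ω φ)
    (hψ : ContDiff ℝ ((⊤ : ℕ∞) : WithTop ℕ∞) ψ) : IsTestFunction Ω (fun x => φ x * ψ x) :=
  ⟨h.1.mul hψ, h.2.1.mul_right, (tsupport_mul_subset_left).trans h.2.2⟩

theorem contDiff_mul {φ ψ : EuclideanSpace ℝ (Fin N) → ℝ} (h : IsTestFunction Ω φ)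
    (hψ : ContDiff ℝ ((⊤ : ℕ∞) : WithTop ℕ∞) ψ) : IsTestFunction Ω (fun x => ψ x * φ x) := by
  simpa only [mul_comm] using h.mul_contDiff hψ

theorem const_mul {φ : EuclideanSpace ℝ (Fin N) → ℝ} (h : IsTestFunction Ω φ) (c : ℝ) :
    IsTestFunction Ω (fun x => c * φ x) := h.contDiff_mul contDiff_const

theorem add {φ ψ : EuclideanSpace ℝ (Fin N) → ℝ} (h : IsTestFunction Ω φ)
    (h' : IsTestFunction Ω ψ) : IsTestFunction Ω (fun x => φ x + ψ x) :=
  ⟨h.1.add h'.1, h.2.1.add h'.2.1,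
    (tsupport_add φ ψ).trans (Set.union_subset h.2.2 h'.2.2)⟩

theorem zero : IsTestFunction Ω (fun _ => 0) :=
  ⟨contDiff_const, HasCompactSupport.zero, by
    have : (fun _ : EuclideanSpace ℝ (Fin N) => (0 : ℝ)) = 0 := rfl
    rw [this, tsupport_zero]; exact Set.empty_subset _⟩

theorem hasCompactSupport_gradient {φ : EuclideanSpace ℝ (Fin N) → ℝ} (h : IsTestFunction Ω φ) :
    HasCompactSupport (gradient φ) :=
  (h.2.1.fderiv ℝ).comp_left (g := (InnerProductSpace.toDual ℝ _).symm) (map_zero _)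

theorem gradient_coord {φ : EuclideanSpace ℝ (Fin N) → ℝ} (h : IsTestFunction Ω φ) (j : Fin N) :
    IsTestFunction Ω (fun x => gradient φ x j) := by
  simp only [gradient_apply_eq_fderiv]
  refine ⟨(h.1.fderiv_right (by simp)).clm_apply contDiff_const, h.2.1.fderiv_apply ℝ _, ?_⟩
  exact (tsupport_fderiv_apply_subset ℝ _).trans h.2.2

theorem memLp {φ : EuclideanSpace ℝ (Fin N) → ℝ} (h : IsTestFunction Ω φ) (p : ENNReal)
    (S : Set (EuclideanSpace ℝ (Fin N))) :
    MemLp φ p (volume.restrict S) := (h.1.continuous.memLp_of_hasCompactSupport h.2.1).restrict S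

theorem memLp_gradient {φ : EuclideanSpace ℝ (Fin N) → ℝ} (h : IsTestFunction Ω φ) (p : ENNReal)
    (S : Set (EuclideanSpace ℝ (Fin N))) :
    MemLp (gradient φ) p (volume.restrict S) :=
  ((contDiff_gradient h.1).continuous.memLp_of_hasCompactSupport
    h.hasCompactSupport_gradient).restrict S

theorem exists_bound {φ : EuclideanSpace ℝ (Fin N) → ℝ} (h : IsTestFunction Ω φ) :
    ∃ C : ℝ, 0 ≤ C ∧ ∀ x, ‖φ x‖ ≤ C := by
  obtain ⟨C, hC⟩ := h.1.continuous.bounded_above_of_compact_support h.2.1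
  exact ⟨C, (norm_nonneg _).trans (hC 0), hC⟩

theorem exists_bound_gradient {φ : EuclideanSpace ℝ (Fin N) → ℝ} (h : IsTestFunction Ω φ) :
    ∃ C : ℝ, 0 ≤ C ∧ ∀ x, ‖gradient φ x‖ ≤ C := by
  obtain ⟨C, hC⟩ := (contDiff_gradient h.1).continuous.bounded_above_of_compact_support
    h.hasCompactSupport_gradient
  exact ⟨C, (norm_nonneg _).trans (hC 0), hC⟩

end IsTestFunction
end TestFunctions

/-! ### The Poincaré inequality and Rellich's theorem by Fourier transform -/

section Fourier
open FourierTransform SchwartzMap LineDeriv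
variable {N : ℕ} {Ω : Set (EuclideanSpace ℝ (Fin N))}

theorem norm_sq_fourier_lineDeriv (f : 𝓢(EuclideanSpace ℝ (Fin N), ℂ)) (j : Fin N)
    (ξ : EuclideanSpace ℝ (Fin N)) :
    ‖𝓕 (∂_{(EuclideanSpace.single j (1 : ℝ))} f) ξ‖ ^ 2 =
      (2 * Real.pi) ^ 2 * (ξ j ^ 2 * ‖𝓕 f ξ‖ ^ 2) := by
  rw [fourier_lineDerivOp_eq]
  have ht : (fun x : EuclideanSpace ℝ (Fin N) =>
      inner ℝ x (EuclideanSpace.single j (1 : ℝ))).HasTemperateGrowth :=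
    ((innerSL ℝ).flip (EuclideanSpace.single j (1 : ℝ))).hasTemperateGrowth
  simp only [smul_apply, smulLeftCLM_apply_apply ht]
  simp [mul_pow, EuclideanSpace.inner_single_right]

theorem SchwartzMap.integrable_norm_sq (f : 𝓢(EuclideanSpace ℝ (Fin N), ℂ)) :
    Integrable (fun x => ‖f x‖ ^ 2) :=
  (memLp_two_iff_integrable_sq_norm (f.continuous.aestronglyMeasurable)).1 (f.memLp 2 volume)

/-- A real test function, as a complex-valued Schwartz function. -/
noncomputable def IsTestFunction.toComplexSchwartz {φ : EuclideanSpace ℝ (Fin N) → ℝ}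
    (h : IsTestFunction Ω φ) : 𝓢(EuclideanSpace ℝ (Fin N), ℂ) :=
  HasCompactSupport.toSchwartzMap (f := fun x => (φ x : ℂ))
    (h.2.1.comp_left (g := fun t : ℝ => (t : ℂ)) Complex.ofReal_zero)
    (Complex.ofRealCLM.contDiff.comp h.1)

theorem IsTestFunction.toComplexSchwartz_apply {φ : EuclideanSpace ℝ (Fin N) → ℝ}
    (h : IsTestFunction Ω φ) (x : EuclideanSpace ℝ (Fin N)) :
    h.toComplexSchwartz x = (φ x : ℂ) := rfl

theorem IsTestFunction.norm_sq_lineDeriv_toComplexSchwartz {φ : EuclideanSpace ℝ (Fin N) → ℝ}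
    (h : IsTestFunction Ω φ) (j : Fin N) (x : EuclideanSpace ℝ (Fin N)) :
    ‖(∂_{(EuclideanSpace.single j (1 : ℝ))} h.toComplexSchwartz) x‖ ^ 2 = gradient φ x j ^ 2 := by
  rw [lineDerivOp_apply_eq_fderiv]
  have : (h.toComplexSchwartz : EuclideanSpace ℝ (Fin N) → ℂ) = Complex.ofRealCLM ∘ φ := rfl
  rw [this, (Complex.ofRealCLM.hasFDerivAt.comp x
    h.differentiable.differentiableAt.hasFDerivAt).fderiv, gradient_apply_eq_fderiv]
  simp

theorem IsTestFunction.integral_frequency_sq {φ : EuclideanSpace ℝ (Fin N) → ℝ}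
    (h : IsTestFunction Ω φ) :
    Integrable (fun ξ : EuclideanSpace ℝ (Fin N) => ‖ξ‖ ^ 2 * ‖𝓕 h.toComplexSchwartz ξ‖ ^ 2) ∧
    (2 * Real.pi) ^ 2 *
      ∫ ξ : EuclideanSpace ℝ (Fin N), ‖ξ‖ ^ 2 * ‖𝓕 h.toComplexSchwartz ξ‖ ^ 2 =
      ∫ x, ‖gradient φ x‖ ^ 2 := by
  have hi : ∀ j : Fin N, Integrable (fun ξ : EuclideanSpace ℝ (Fin N) =>
      (2 * Real.pi) ^ 2 * (ξ j ^ 2 * ‖𝓕 h.toComplexSchwartz ξ‖ ^ 2)) := fun j =>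
    (𝓕 (∂_{(EuclideanSpace.single j (1 : ℝ))} h.toComplexSchwartz)).integrable_norm_sq.congr
      (ae_of_all _ fun ξ => norm_sq_fourier_lineDeriv _ j ξ)
  have hg : ∀ j : Fin N, Integrable (fun x => gradient φ x j ^ 2) := fun j =>
    (∂_{(EuclideanSpace.single j (1 : ℝ))} h.toComplexSchwartz).integrable_norm_sq.congr
      (ae_of_all _ fun x => h.norm_sq_lineDeriv_toComplexSchwartz j x)
  have hp : (2 * Real.pi) ^ 2 ≠ 0 := by positivity
  have hs : ∀ ξ : EuclideanSpace ℝ (Fin N), ‖ξ‖ ^ 2 * ‖𝓕 h.toComplexSchwartz ξ‖ ^ 2 =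
      ∑ j, ξ j ^ 2 * ‖𝓕 h.toComplexSchwartz ξ‖ ^ 2 := fun ξ => by
    rw [EuclideanSpace.real_norm_sq_eq, Finset.sum_mul]
  constructor
  · simp only [hs]
    refine integrable_finsetSum _ fun j _ => ?_
    exact (integrable_const_mul_iff (IsUnit.mk0 _ hp) _).1 (hi j)
  · rw [← integral_const_mul]
    simp only [hs, Finset.mul_sum]
    simp only [EuclideanSpace.real_norm_sq_eq]
    rw [integral_finsetSum _ fun j _ => hi j, integral_finsetSum _ fun j _ => hg j]
    refine Finset.sum_congr rfl fun j _ => ?_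
    have := integral_norm_sq_fourier (∂_{(EuclideanSpace.single j (1 : ℝ))} h.toComplexSchwartz)
    rw [← integral_congr_ae (ae_of_all _ fun ξ => norm_sq_fourier_lineDeriv _ j ξ), this]
    exact integral_congr_ae (ae_of_all _ fun x => h.norm_sq_lineDeriv_toComplexSchwartz j x)

/-- Splitting of the `L²` norm into low and high frequencies: the high frequencies are controlled
by the gradient. -/
theorem IsTestFunction.integral_sq_le {φ : EuclideanSpace ℝ (Fin N) → ℝ}
    (h : IsTestFunction Ω φ) {R : ℝ} (hR : 0 < R) :
    ∫ x, φ x ^ 2 ≤ (∫ ξ in Metric.ball (0 : EuclideanSpace ℝ (Fin N)) R,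
      ‖𝓕 h.toComplexSchwartz ξ‖ ^ 2) + ((2 * Real.pi * R) ^ 2)⁻¹ * ∫ x, ‖gradient φ x‖ ^ 2 := by
  obtain ⟨h1, h2⟩ := h.integral_frequency_sq
  have h0 := (𝓕 h.toComplexSchwartz).integrable_norm_sq
  have hpl := integral_norm_sq_fourier h.toComplexSchwartz
  have : ∫ x, φ x ^ 2 = ∫ ξ, ‖𝓕 h.toComplexSchwartz ξ‖ ^ 2 := by
    rw [hpl]; simp [h.toComplexSchwartz_apply]
  rw [this, ← integral_add_compl
    (measurableSet_ball (x := (0 : EuclideanSpace ℝ (Fin N))) (ε := R)) h0]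
  gcongr
  calc ∫ ξ in (Metric.ball (0 : EuclideanSpace ℝ (Fin N)) R)ᶜ, ‖𝓕 h.toComplexSchwartz ξ‖ ^ 2
      ≤ ∫ ξ in (Metric.ball (0 : EuclideanSpace ℝ (Fin N)) R)ᶜ,
          (R ^ 2)⁻¹ * (‖ξ‖ ^ 2 * ‖𝓕 h.toComplexSchwartz ξ‖ ^ 2) := by
        refine setIntegral_mono_on h0.integrableOn (h1.const_mul _).integrableOn
          measurableSet_ball.compl fun ξ hξ => ?_
        have hξ' : R ≤ ‖ξ‖ := by simpa using hξ
        have : 1 ≤ (R ^ 2)⁻¹ * ‖ξ‖ ^ 2 := by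
          rw [← div_eq_inv_mul, one_le_div (by positivity)]; gcongr
        rw [← mul_assoc]
        exact le_mul_of_one_le_left (by positivity) this
    _ ≤ ∫ ξ : EuclideanSpace ℝ (Fin N),
          (R ^ 2)⁻¹ * (‖ξ‖ ^ 2 * ‖𝓕 h.toComplexSchwartz ξ‖ ^ 2) :=
        setIntegral_le_integral (h1.const_mul _) (ae_of_all _ fun ξ => by positivity)
    _ = _ := by
        rw [integral_const_mul, ← h2]
        field_simp

theorem IsTestFunction.fourier_toComplexSchwartz {φ : EuclideanSpace ℝ (Fin N) → ℝ}
    (h : IsTestFunction Ω φ) (ξ : EuclideanSpace ℝ (Fin N)) :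
    𝓕 h.toComplexSchwartz ξ = ∫ x in Ω, Real.fourierChar (-inner ℝ x ξ) • (φ x : ℂ) := by
  rw [fourier_coe, Real.fourier_eq, setIntegral_eq_integral_of_forall_compl_eq_zero]
  · rfl
  · intro x hx
    rw [image_eq_zero_of_notMem_tsupport (fun hx' => hx (h.2.2 hx'))]
    simp

/-- The Cauchy–Schwarz bound `‖𝓕 φ‖_∞ ≤ ‖φ‖₁ ≤ |Ω|^(1/2) ‖φ‖₂`. -/
theorem IsTestFunction.norm_fourier_sq_le {φ : EuclideanSpace ℝ (Fin N) → ℝ}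
    (h : IsTestFunction Ω φ) (hΩb : Bornology.IsBounded Ω) (ξ : EuclideanSpace ℝ (Fin N)) :
    ‖𝓕 h.toComplexSchwartz ξ‖ ^ 2 ≤ volume.real Ω * ∫ x in Ω, φ x ^ 2 := by
  have hfin : IsFiniteMeasure (volume.restrict Ω) := ⟨by
    simpa using hΩb.measure_lt_top⟩
  have h1 : ‖𝓕 h.toComplexSchwartz ξ‖ ≤ ∫ x in Ω, |φ x| := by
    rw [h.fourier_toComplexSchwartz]
    refine (norm_integral_le_integral_norm _).trans (le_of_eq ?_)
    simp
  have hm := (h.memLp 2 Ω).norm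
  have h2 : ∫ x in Ω, |φ x| ≤ (eLpNorm (fun x => ‖φ x‖) 2 (volume.restrict Ω)).toReal *
      (eLpNorm (fun _ => (1 : ℝ)) 2 (volume.restrict Ω)).toReal := by
    have := abs_integral_inner_le hm (memLp_const (1 : ℝ))
    refine le_trans (le_of_eq ?_) ((le_abs_self _).trans this)
    simp
  have h3 := integral_norm_sq_eq (memLp_const (p := 2) (μ := volume.restrict Ω) (1 : ℝ))
  have h4 := integral_norm_sq_eq hm
  calc ‖𝓕 h.toComplexSchwartz ξ‖ ^ 2 ≤ (∫ x in Ω, |φ x|) ^ 2 := by gcongr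
    _ ≤ _ := by
      refine (pow_le_pow_left₀ (integral_nonneg fun _ => abs_nonneg _) h2 2).trans ?_
      rw [mul_pow, ← h3, ← h4]
      simp [mul_comm, Measure.real]

theorem IsTestFunction.eLpNorm_sq_eq {φ : EuclideanSpace ℝ (Fin N) → ℝ}
    (h : IsTestFunction Ω φ) :
    (eLpNorm φ 2 (volume.restrict Ω)).toReal ^ 2 = ∫ x, φ x ^ 2 := by
  rw [← integral_norm_sq_eq (h.memLp 2 Ω), setIntegral_eq_integral_of_forall_compl_eq_zero]
  · simp
  · intro x hx
    rw [image_eq_zero_of_notMem_tsupport (fun hx' => hx (h.2.2 hx'))]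
    simp

theorem IsTestFunction.eLpNorm_gradient_sq_eq {φ : EuclideanSpace ℝ (Fin N) → ℝ}
    (h : IsTestFunction Ω φ) :
    (eLpNorm (gradient φ) 2 (volume.restrict Ω)).toReal ^ 2 = ∫ x, ‖gradient φ x‖ ^ 2 := by
  rw [← integral_norm_sq_eq (h.memLp_gradient 2 Ω), setIntegral_eq_integral_of_forall_compl_eq_zero]
  intro x hx
  have : fderiv ℝ φ x = 0 :=
    image_eq_zero_of_notMem_tsupport (fun hx' => hx (h.2.2 (tsupport_fderiv_subset ℝ hx')))
  simp [gradient, this]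

/-- The Poincaré inequality in a bounded set, for test functions. The low frequencies
`|ξ| < R` are absorbed for small `R`, as `‖𝓕 φ‖_∞ ≤ |Ω|^(1/2) ‖φ‖₂`; this uses `N ≠ 0`, so that the
volume of the ball of radius `R` tends to zero with `R`. -/
theorem exists_poincare [NeZero N] (hΩb : Bornology.IsBounded Ω) :
    ∃ C : ℝ, 0 ≤ C ∧ ∀ φ : EuclideanSpace ℝ (Fin N) → ℝ, IsTestFunction Ω φ →
      (eLpNorm φ 2 (volume.restrict Ω)).toReal ≤
        C * (eLpNorm (gradient φ) 2 (volume.restrict Ω)).toReal := by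
  set c : ℝ := volume.real (Metric.ball (0 : EuclideanSpace ℝ (Fin N)) 1) * volume.real Ω with hc
  have hc0 : 0 ≤ c := by positivity
  -- This choice makes `|B_R| |Ω| ≤ R c ≤ 1 / 2`.
  set R : ℝ := 1 / (2 * (c + 1)) with hR
  have hR0 : 0 < R := by positivity
  have hR1 : R ≤ 1 := by
    rw [hR, div_le_one (by positivity)]; linarith
  have hball : volume.real (Metric.ball (0 : EuclideanSpace ℝ (Fin N)) R) * volume.real Ω ≤
      1 / 2 := by
    have h1 : volume.real (Metric.ball (0 : EuclideanSpace ℝ (Fin N)) R) =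
        R ^ N * volume.real (Metric.ball (0 : EuclideanSpace ℝ (Fin N)) 1) := by
      simp only [Measure.real]
      rw [Measure.addHaar_ball_of_pos volume _ hR0, ENNReal.toReal_mul,
        ENNReal.toReal_ofReal (by positivity)]
      simp
    rw [h1, mul_assoc, ← hc]
    calc R ^ N * c ≤ R * c := by
          gcongr
          exact pow_le_of_le_one hR0.le hR1 (NeZero.ne N)
      _ ≤ 1 / 2 := by
          rw [hR, div_mul_eq_mul_div, div_le_div_iff₀ (by positivity) (by norm_num)]; linarith
  refine ⟨Real.sqrt (2 * ((2 * Real.pi * R) ^ 2)⁻¹), by positivity, fun φ h => ?_⟩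
  have h1 := h.integral_sq_le hR0
  have h2 : (∫ ξ in Metric.ball (0 : EuclideanSpace ℝ (Fin N)) R,
      ‖𝓕 h.toComplexSchwartz ξ‖ ^ 2) ≤ 1 / 2 * ∫ x, φ x ^ 2 := by
    have hb : ∀ ξ ∈ Metric.ball (0 : EuclideanSpace ℝ (Fin N)) R,
        ‖𝓕 h.toComplexSchwartz ξ‖ ^ 2 ≤ volume.real Ω * ∫ x, φ x ^ 2 := fun ξ _ => by
      have := h.norm_fourier_sq_le hΩb ξ
      rwa [show ∫ x in Ω, φ x ^ 2 = ∫ x, φ x ^ 2 by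
        rw [← h.eLpNorm_sq_eq, ← integral_norm_sq_eq (h.memLp 2 Ω)]; simp] at this
    have hfin : volume (Metric.ball (0 : EuclideanSpace ℝ (Fin N)) R) ≠ ⊤ := measure_ball_lt_top.ne
    have h3 := setIntegral_mono_on (𝓕 h.toComplexSchwartz).integrable_norm_sq.integrableOn
      (integrableOn_const hfin) measurableSet_ball hb
    rw [setIntegral_const, smul_eq_mul, ← mul_assoc] at h3
    exact h3.trans (mul_le_mul_of_nonneg_right hball (integral_nonneg fun _ => sq_nonneg _))
  rw [← h.eLpNorm_sq_eq] at h1 h2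
  rw [← h.eLpNorm_gradient_sq_eq] at h1
  refine (sq_le_sq₀ ENNReal.toReal_nonneg (by positivity)).1 ?_
  rw [mul_pow, Real.sq_sqrt (by positivity)]
  linarith

/-- Rellich's theorem for test functions: bounded gradients and weak convergence to zero imply
strong convergence to zero in `L²`. The Fourier transforms are uniformly bounded and converge to
zero pointwise, so that dominated convergence applies to each ball of frequencies. -/
theorem IsTestFunction.tendsto_eLpNorm_zero [NeZero N] (hΩb : Bornology.IsBounded Ω)
    {φ : ℕ → EuclideanSpace ℝ (Fin N) → ℝ} (h : ∀ n, IsTestFunction Ω (φ n))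
    {C : ℝ} (hC : ∀ n, (eLpNorm (gradient (φ n)) 2 (volume.restrict Ω)).toReal ≤ C)
    (hw : ∀ ψ : EuclideanSpace ℝ (Fin N) → ℝ, MemLp ψ 2 (volume.restrict Ω) →
      Tendsto (fun n => ∫ x in Ω, φ n x * ψ x) atTop (𝓝 0)) :
    Tendsto (fun n => (eLpNorm (φ n) 2 (volume.restrict Ω)).toReal) atTop (𝓝 0) := by
  have hfin : IsFiniteMeasure (volume.restrict Ω) := ⟨by simpa using hΩb.measure_lt_top⟩
  obtain ⟨P, hP0, hP⟩ := exists_poincare hΩb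
  have hb : ∀ n ξ, ‖𝓕 (h n).toComplexSchwartz ξ‖ ^ 2 ≤ volume.real Ω * (P * C) ^ 2 := fun n ξ => by
    refine ((h n).norm_fourier_sq_le hΩb ξ).trans ?_
    gcongr
    have h1 : ∫ x in Ω, φ n x ^ 2 = (eLpNorm (φ n) 2 (volume.restrict Ω)).toReal ^ 2 := by
      rw [← integral_norm_sq_eq ((h n).memLp 2 Ω)]; simp
    rw [h1]
    gcongr
    exact (hP _ (h n)).trans (mul_le_mul_of_nonneg_left (hC n) hP0)
  have hpt : ∀ ξ, Tendsto (fun n => ‖𝓕 (h n).toComplexSchwartz ξ‖ ^ 2) atTop (𝓝 0) := fun ξ => by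
    have hre : ∀ n, 𝓕 (h n).toComplexSchwartz ξ =
        ((∫ x in Ω, φ n x * Real.cos (2 * Real.pi * inner ℝ x ξ) : ℝ) : ℂ) -
        ((∫ x in Ω, φ n x * Real.sin (2 * Real.pi * inner ℝ x ξ) : ℝ) : ℂ) *
          Complex.I := fun n => by
      rw [(h n).fourier_toComplexSchwartz, ← integral_complex_ofReal, ← integral_complex_ofReal,
        ← integral_mul_const, ← integral_sub]
      · congr 1
        ext x
        rw [Circle.smul_def, Real.fourierChar_apply]
        push_cast
        rw [Complex.exp_mul_I]
        simp only [smul_eq_mul, mul_neg, Complex.cos_neg, Complex.sin_neg]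
        ring
      · refine Integrable.ofReal ?_
        refine ((h n).memLp 1 Ω).integrable le_rfl |>.mul_bdd (c := 1) ?_ ?_
        · exact (by fun_prop : Continuous _).aestronglyMeasurable
        · exact ae_of_all _ fun x => Real.abs_cos_le_one _
      · refine Integrable.mul_const (Integrable.ofReal ?_) _
        refine ((h n).memLp 1 Ω).integrable le_rfl |>.mul_bdd (c := 1) ?_ ?_
        · exact (by fun_prop : Continuous _).aestronglyMeasurable
        · exact ae_of_all _ fun x => Real.abs_sin_le_one _
    have hcos := hw (fun x => Real.cos (2 * Real.pi * inner ℝ x ξ))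
      (MemLp.of_bound (by fun_prop : Continuous _).aestronglyMeasurable 1
        (ae_of_all _ fun x => Real.abs_cos_le_one _))
    have hsin := hw (fun x => Real.sin (2 * Real.pi * inner ℝ x ξ))
      (MemLp.of_bound (by fun_prop : Continuous _).aestronglyMeasurable 1
        (ae_of_all _ fun x => Real.abs_sin_le_one _))
    have := ((((Complex.continuous_ofReal.tendsto 0).comp hcos).sub
      (((Complex.continuous_ofReal.tendsto 0).comp hsin).mul_const Complex.I)).norm.pow 2)
    simp only [hre]
    simpa using this
  have hsq : Tendsto (fun n => ∫ x, φ n x ^ 2) atTop (𝓝 0) := by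
    have hlow : ∀ R : ℝ, Tendsto (fun n => ∫ ξ in Metric.ball (0 : EuclideanSpace ℝ (Fin N)) R,
        ‖𝓕 (h n).toComplexSchwartz ξ‖ ^ 2) atTop (𝓝 0) := fun R => by
      have := tendsto_integral_of_dominated_convergence
        (μ := volume.restrict (Metric.ball (0 : EuclideanSpace ℝ (Fin N)) R))
        (F := fun n ξ => ‖𝓕 (h n).toComplexSchwartz ξ‖ ^ 2) (f := fun _ => (0 : ℝ))
        (fun _ => volume.real Ω * (P * C) ^ 2)
        (fun n => (𝓕 (h n).toComplexSchwartz).integrable_norm_sq.aestronglyMeasurable.restrict)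
        (integrableOn_const measure_ball_lt_top.ne)
        (fun n => ae_of_all _ fun ξ => by
          simpa using hb n ξ)
        (ae_of_all _ hpt)
      simpa using this
    rw [Metric.tendsto_atTop]
    intro ε hε
    have hlim : Tendsto (fun R : ℝ => ((2 * Real.pi * R) ^ 2)⁻¹ * C ^ 2) atTop (𝓝 0) := by
      have : Tendsto (fun R : ℝ => (2 * Real.pi * R) ^ 2) atTop atTop :=
        (tendsto_pow_atTop two_ne_zero).comp (tendsto_id.const_mul_atTop (by positivity))
      simpa using this.inv_tendsto_atTop.mul_const (C ^ 2)
    obtain ⟨R, hR1, hR0⟩ := ((hlim.eventually_lt_const (half_pos hε)).and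
      (eventually_gt_atTop 0)).exists
    obtain ⟨n₀, hn₀⟩ := eventually_atTop.1 ((hlow R).eventually_lt_const (half_pos hε))
    refine ⟨n₀, fun n hn => ?_⟩
    rw [Real.dist_0_eq_abs, abs_of_nonneg (integral_nonneg fun _ => sq_nonneg _)]
    have h1 := (h n).integral_sq_le hR0
    rw [← (h n).eLpNorm_gradient_sq_eq] at h1
    have h2 : ((2 * Real.pi * R) ^ 2)⁻¹ *
        (eLpNorm (gradient (φ n)) 2 (volume.restrict Ω)).toReal ^ 2 ≤
        ((2 * Real.pi * R) ^ 2)⁻¹ * C ^ 2 := by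
      gcongr
      exact hC n
    have h3 := hn₀ n hn
    linarith
  have := hsq.sqrt
  simp only [← (h _).eLpNorm_sq_eq] at this
  simpa [Real.sqrt_sq] using this

end Fourier

/-! ### The space `H¹₀(Ω)` -/

section MemH10
variable {N : ℕ} {Ω : Set (EuclideanSpace ℝ (Fin N))}

/-- Membership in `H¹₀(Ω)`, with `ε`-approximation in place of approximating sequences. -/
theorem memH10_iff {u : EuclideanSpace ℝ (Fin N) → ℝ}
    {G : EuclideanSpace ℝ (Fin N) → EuclideanSpace ℝ (Fin N)} :
    MemH10 Ω u G ↔ MemLp u 2 (volume.restrict Ω) ∧ MemLp G 2 (volume.restrict Ω) ∧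
      ∀ ε : ENNReal, 0 < ε → ∃ φ : EuclideanSpace ℝ (Fin N) → ℝ, IsTestFunction Ω φ ∧
        eLpNorm (fun x => u x - φ x) 2 (volume.restrict Ω) ≤ ε ∧
        eLpNorm (fun x => G x - gradient φ x) 2 (volume.restrict Ω) ≤ ε := by
  constructor
  · rintro ⟨hu, hG, φ, hφ, h1, h2⟩
    refine ⟨hu, hG, fun ε hε => ?_⟩
    obtain ⟨n, hn1, hn2⟩ := ((h1.eventually_le_const hε).and (h2.eventually_le_const hε)).exists
    exact ⟨φ n, hφ n, hn1, hn2⟩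
  · rintro ⟨hu, hG, h⟩
    choose φ hφ h1 h2 using fun n : ℕ => h ((n : ENNReal) + 1)⁻¹ (by simp)
    have hlim : Tendsto (fun n : ℕ => ((n : ENNReal) + 1)⁻¹) atTop (𝓝 0) := by
      have := (tendsto_add_atTop_iff_nat 1).2 ENNReal.tendsto_inv_nat_nhds_zero
      simpa using this
    exact ⟨hu, hG, φ, hφ, tendsto_of_tendsto_of_tendsto_of_le_of_le tendsto_const_nhds hlim
      (fun _ => zero_le) h1, tendsto_of_tendsto_of_tendsto_of_le_of_le tendsto_const_nhds hlim
      (fun _ => zero_le) h2⟩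

theorem IsTestFunction.memH10 {φ : EuclideanSpace ℝ (Fin N) → ℝ} (h : IsTestFunction Ω φ) :
    MemH10 Ω φ (gradient φ) :=
  ⟨h.memLp 2 Ω, h.memLp_gradient 2 Ω, fun _ => φ, fun _ => h, by simp, by simp⟩

namespace MemH10

variable {u v : EuclideanSpace ℝ (Fin N) → ℝ}
  {G H : EuclideanSpace ℝ (Fin N) → EuclideanSpace ℝ (Fin N)}

theorem congr_ae (h : MemH10 Ω u G) (hu : u =ᵐ[volume.restrict Ω] v)
    (hG : G =ᵐ[volume.restrict Ω] H) : MemH10 Ω v H := by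
  obtain ⟨h1, h2, φ, hφ, h3, h4⟩ := h
  refine ⟨h1.ae_eq hu, h2.ae_eq hG, φ, hφ, h3.congr fun n => ?_, h4.congr fun n => ?_⟩
  · exact eLpNorm_congr_ae (hu.sub (EventuallyEq.refl _ (φ n)))
  · exact eLpNorm_congr_ae (hG.sub (EventuallyEq.refl _ (gradient (φ n))))

theorem add (h : MemH10 Ω u G) (h' : MemH10 Ω v H) :
    MemH10 Ω (fun x => u x + v x) (fun x => G x + H x) := by
  obtain ⟨h1, h2, φ, hφ, h3, h4⟩ := h
  obtain ⟨h1', h2', ψ, hψ, h3', h4'⟩ := h'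
  refine ⟨h1.add h1', h2.add h2', fun n x => φ n x + ψ n x, fun n => (hφ n).add (hψ n), ?_, ?_⟩
  · refine tendsto_of_tendsto_of_tendsto_of_le_of_le tendsto_const_nhds
      (by simpa using h3.add h3') (fun _ => zero_le) fun n => ?_
    refine le_trans (le_of_eq ?_) (eLpNorm_add_le (h1.sub ((hφ n).memLp 2 Ω)).1
      (h1'.sub ((hψ n).memLp 2 Ω)).1 (by norm_num))
    congr 1
    ext x
    simp only [Pi.add_apply]
    ring
  · refine tendsto_of_tendsto_of_tendsto_of_le_of_le tendsto_const_nhds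
      (by simpa using h4.add h4') (fun _ => zero_le) fun n => ?_
    refine le_trans (le_of_eq ?_) (eLpNorm_add_le (h2.sub ((hφ n).memLp_gradient 2 Ω)).1
      (h2'.sub ((hψ n).memLp_gradient 2 Ω)).1 (by norm_num))
    congr 1
    ext1 x
    rw [gradient_fun_add (hφ n).differentiable.differentiableAt
      (hψ n).differentiable.differentiableAt]
    simp only [Pi.add_apply]
    abel

theorem const_mul (h : MemH10 Ω u G) (c : ℝ) : MemH10 Ω (fun x => c * u x) (fun x => c • G x) := by
  obtain ⟨h1, h2, φ, hφ, h3, h4⟩ := h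
  refine ⟨h1.const_mul c, h2.const_smul c, fun n x => c * φ n x, fun n => (hφ n).const_mul c,
    ?_, ?_⟩
  · have := ENNReal.Tendsto.const_mul (a := ‖c‖ₑ) h3 (Or.inr enorm_ne_top)
    rw [mul_zero] at this
    refine this.congr fun n => ?_
    rw [← eLpNorm_const_smul]
    congr 1
    ext x
    simp [mul_sub]
  · have := ENNReal.Tendsto.const_mul (a := ‖c‖ₑ) h4 (Or.inr enorm_ne_top)
    rw [mul_zero] at this
    refine this.congr fun n => ?_
    rw [← eLpNorm_const_smul]
    congr 1
    ext1 x
    rw [gradient_const_mul c (hφ n).differentiable.differentiableAt]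
    simp [smul_sub]

theorem zero : MemH10 Ω (fun _ => 0) (fun _ => 0) := by
  have h := (IsTestFunction.zero (Ω := Ω)).memH10
  have h0 : gradient (fun _ : EuclideanSpace ℝ (Fin N) => (0 : ℝ)) = fun _ => 0 := by
    ext1 x; simp [gradient_fun_const]
  rwa [h0] at h

theorem sub (h : MemH10 Ω u G) (h' : MemH10 Ω v H) :
    MemH10 Ω (fun x => u x - v x) (fun x => G x - H x) := by
  simpa [sub_eq_add_neg] using h.add (h'.const_mul (-1))

theorem finset_sum {ι : Type*} (s : Finset ι) {u : ι → EuclideanSpace ℝ (Fin N) → ℝ}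
    {G : ι → EuclideanSpace ℝ (Fin N) → EuclideanSpace ℝ (Fin N)}
    (h : ∀ i ∈ s, MemH10 Ω (u i) (G i)) :
    MemH10 Ω (fun x => ∑ i ∈ s, u i x) (fun x => ∑ i ∈ s, G i x) := by
  classical
  induction s using Finset.induction_on with
  | empty => simpa using zero
  | insert i s hi ih =>
    simp only [Finset.sum_insert hi]
    exact (h i (Finset.mem_insert_self _ _)).add
      (ih fun j hj => h j (Finset.mem_insert_of_mem hj))

/-- The product rule: multiplication by a test function maps `H¹₀(Ω)` to itself. -/
theorem test_mul {φ : EuclideanSpace ℝ (Fin N) → ℝ} (hφ : IsTestFunction Ω φ)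
    (h : MemH10 Ω u G) :
    MemH10 Ω (fun x => φ x * u x) (fun x => φ x • G x + u x • gradient φ x) := by
  obtain ⟨h1, h2, ψ, hψ, h3, h4⟩ := h
  obtain ⟨C, hC0, hC⟩ := hφ.exists_bound
  obtain ⟨C', hC0', hC'⟩ := hφ.exists_bound_gradient
  have hφm := hφ.1.continuous.aestronglyMeasurable (μ := volume.restrict Ω)
  have hgm := (contDiff_gradient hφ.1).continuous.aestronglyMeasurable (μ := volume.restrict Ω)
  have hl {f : EuclideanSpace ℝ (Fin N) → ℝ} (hf : MemLp f 2 (volume.restrict Ω)) :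
      MemLp (fun x => f x • gradient φ x) 2 (volume.restrict Ω) :=
    memLp_smul_of_norm_le hf hgm hC'
  have e3 := ENNReal.Tendsto.const_mul (a := ENNReal.ofReal C) h3 (Or.inr ENNReal.ofReal_ne_top)
  have e3' := ENNReal.Tendsto.const_mul (a := ENNReal.ofReal C') h3 (Or.inr ENNReal.ofReal_ne_top)
  have e4 := ENNReal.Tendsto.const_mul (a := ENNReal.ofReal C) h4 (Or.inr ENNReal.ofReal_ne_top)
  have e5 := e4.add e3'
  simp only [mul_zero, add_zero] at e3 e5
  refine ⟨memLp_two_mul_of_bound hφm (ae_of_all _ hC) h1,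
    (memLp_two_mul_of_bound hφm (ae_of_all _ hC) h2).add (hl h1),
    fun n x => φ x * ψ n x, fun n => hφ.mul_contDiff (hψ n).1, ?_, ?_⟩
  · refine tendsto_of_tendsto_of_tendsto_of_le_of_le tendsto_const_nhds e3 (fun _ => zero_le)
      fun n => eLpNorm_le_mul_eLpNorm_of_ae_le_mul (ae_of_all _ fun x => ?_) 2
    rw [← mul_sub, norm_mul]
    gcongr
    exact hC x
  · refine tendsto_of_tendsto_of_tendsto_of_le_of_le tendsto_const_nhds e5 (fun _ => zero_le)
      fun n => ?_
    have hs := h2.sub ((hψ n).memLp_gradient 2 Ω)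
    have hs' := h1.sub ((hψ n).memLp 2 Ω)
    calc eLpNorm (fun x => φ x • G x + u x • gradient φ x -
            gradient (fun y => φ y * ψ n y) x) 2 (volume.restrict Ω)
        = eLpNorm ((fun x => φ x • (G x - gradient (ψ n) x)) +
            fun x => (u x - ψ n x) • gradient φ x) 2 (volume.restrict Ω) := by
          congr 1
          ext1 x
          rw [gradient_mul hφ.differentiable.differentiableAt
            (hψ n).differentiable.differentiableAt]
          simp only [Pi.add_apply, smul_sub, sub_smul]
          abel
      _ ≤ _ := eLpNorm_add_le (hφm.smul hs.1) (hs'.1.smul hgm) (by norm_num)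
      _ ≤ _ := by
          refine add_le_add (eLpNorm_le_mul_eLpNorm_of_ae_le_mul (ae_of_all _ fun x => ?_) 2)
            (eLpNorm_le_mul_eLpNorm_of_ae_le_mul (ae_of_all _ fun x => ?_) 2)
          · rw [norm_smul]
            gcongr
            exact hC x
          · rw [norm_smul, mul_comm]
            gcongr
            exact hC' x

/-- Two vector fields with the same divergence have the same pairing with every element of
`H¹₀(Ω)`, not only with test functions. -/
theorem integral_inner_eq {D F : EuclideanSpace ℝ (Fin N) → EuclideanSpace ℝ (Fin N)}
    (hD : MemLp D 2 (volume.restrict Ω)) (hF : MemLp F 2 (volume.restrict Ω))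
    (hDF : ∀ φ : EuclideanSpace ℝ (Fin N) → ℝ, IsTestFunction Ω φ →
      ∫ x in Ω, inner ℝ (D x) (gradient φ x) = ∫ x in Ω, inner ℝ (F x) (gradient φ x))
    (h : MemH10 Ω u G) :
    ∫ x in Ω, inner ℝ (D x) (G x) = ∫ x in Ω, inner ℝ (F x) (G x) := by
  obtain ⟨h1, h2, φ, hφ, h3, h4⟩ := h
  have key : ∀ {K : EuclideanSpace ℝ (Fin N) → EuclideanSpace ℝ (Fin N)},
      MemLp K 2 (volume.restrict Ω) →
      Tendsto (fun n => ∫ x in Ω, inner ℝ (K x) (gradient (φ n) x)) atTop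
        (𝓝 (∫ x in Ω, inner ℝ (K x) (G x))) := by
    intro K hK
    have h5 := tendsto_integral_inner_zero (fun _ : ℕ => hK)
      (fun n => h2.sub ((hφ n).memLp_gradient 2 Ω)) (fun _ => le_rfl)
      ((ENNReal.tendsto_toReal_zero_iff fun n =>
        (h2.sub ((hφ n).memLp_gradient 2 Ω)).eLpNorm_ne_top).2 h4)
    have h6 := (tendsto_const_nhds (x := ∫ x in Ω, inner ℝ (K x) (G x))).sub h5
    rw [sub_zero] at h6
    refine h6.congr fun n => ?_
    rw [← integral_sub (integrable_inner_of_memLp hK h2)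
      (integrable_inner_of_memLp hK (h2.sub ((hφ n).memLp_gradient 2 Ω)))]
    congr 1
    ext x
    simp [inner_sub_right]
  exact tendsto_nhds_unique ((key hD).congr fun n => hDF _ (hφ n)) (key hF)

end MemH10

/-- The Poincaré inequality in `H¹₀(Ω)`. -/
theorem exists_poincare_memH10 [NeZero N] (hΩb : Bornology.IsBounded Ω) :
    ∃ C : ℝ, 0 ≤ C ∧ ∀ u G, MemH10 Ω u G →
      (eLpNorm u 2 (volume.restrict Ω)).toReal ≤
        C * (eLpNorm G 2 (volume.restrict Ω)).toReal := by
  obtain ⟨C, hC0, hC⟩ := exists_poincare hΩb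
  refine ⟨C, hC0, fun u G ⟨h1, h2, φ, hφ, h3, h4⟩ => ?_⟩
  have key : ∀ {V : Type} [NormedAddCommGroup V] {f : EuclideanSpace ℝ (Fin N) → V}
      {g : ℕ → EuclideanSpace ℝ (Fin N) → V}, MemLp f 2 (volume.restrict Ω) →
      (∀ n, MemLp (g n) 2 (volume.restrict Ω)) →
      Tendsto (fun n => eLpNorm (fun x => f x - g n x) 2 (volume.restrict Ω)) atTop (𝓝 0) →
      Tendsto (fun n => (eLpNorm (g n) 2 (volume.restrict Ω)).toReal) atTop
        (𝓝 (eLpNorm f 2 (volume.restrict Ω)).toReal) := by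
    intro V _ f g hf hg h
    have h' : Tendsto (fun n => (hg n).toLp (g n)) atTop (𝓝 (hf.toLp f)) := by
      rw [tendsto_iff_edist_tendsto_0]
      refine h.congr fun n => ?_
      rw [edist_comm, Lp.edist_toLp_toLp]
      rfl
    simpa [Lp.norm_toLp] using h'.norm
  exact le_of_tendsto_of_tendsto' (key h1 (fun n => (hφ n).memLp 2 Ω) h3)
    ((key h2 (fun n => (hφ n).memLp_gradient 2 Ω) h4).const_mul C) fun n => hC _ (hφ n)

/-- Rellich's theorem in `H¹₀(Ω)`. -/
theorem MemH10.tendsto_eLpNorm_zero [NeZero N] (hΩb : Bornology.IsBounded Ω)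
    {u : ℕ → EuclideanSpace ℝ (Fin N) → ℝ}
    {G : ℕ → EuclideanSpace ℝ (Fin N) → EuclideanSpace ℝ (Fin N)} (h : ∀ n, MemH10 Ω (u n) (G n))
    {C : ℝ} (hC : ∀ n, (eLpNorm (G n) 2 (volume.restrict Ω)).toReal ≤ C)
    (hw : ∀ ψ : EuclideanSpace ℝ (Fin N) → ℝ, MemLp ψ 2 (volume.restrict Ω) →
      Tendsto (fun n => ∫ x in Ω, u n x * ψ x) atTop (𝓝 0)) :
    Tendsto (fun n => (eLpNorm (u n) 2 (volume.restrict Ω)).toReal) atTop (𝓝 0) := by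
  choose φ hφ h1 h2 using fun n : ℕ => (memH10_iff.1 (h n)).2.2
    (ENNReal.ofReal (1 / ((n : ℝ) + 1))) (ENNReal.ofReal_pos.2 (by positivity))
  have hs1 : ∀ n, MemLp (fun x => u n x - φ n x) 2 (volume.restrict Ω) :=
    fun n => (h n).1.sub ((hφ n).memLp 2 Ω)
  have hs2 : ∀ n, MemLp (fun x => G n x - gradient (φ n) x) 2 (volume.restrict Ω) :=
    fun n => (h n).2.1.sub ((hφ n).memLp_gradient 2 Ω)
  have h1' : ∀ n, (eLpNorm (fun x => u n x - φ n x) 2 (volume.restrict Ω)).toReal ≤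
      1 / ((n : ℝ) + 1) := fun n => ENNReal.toReal_le_of_le_ofReal (by positivity) (h1 n)
  have h0 : Tendsto (fun n => (eLpNorm (fun x => u n x - φ n x) 2 (volume.restrict Ω)).toReal)
      atTop (𝓝 0) :=
    squeeze_zero (fun _ => ENNReal.toReal_nonneg) h1' tendsto_one_div_add_atTop_nhds_zero_nat
  have hbd : ∀ n, (eLpNorm (gradient (φ n)) 2 (volume.restrict Ω)).toReal ≤ C + 1 := fun n => by
    have e : gradient (φ n) = G n - fun x => G n x - gradient (φ n) x := by ext1 x; simp
    have e1 := eLpNorm_sub_le (h n).2.1.1 (hs2 n).1 (p := 2) (by norm_num)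
    rw [← e] at e1
    have e2 := ENNReal.toReal_mono
      (ENNReal.add_ne_top.2 ⟨(h n).2.1.eLpNorm_ne_top, (hs2 n).eLpNorm_ne_top⟩) e1
    rw [ENNReal.toReal_add (h n).2.1.eLpNorm_ne_top (hs2 n).eLpNorm_ne_top] at e2
    have e3 : (eLpNorm (fun x => G n x - gradient (φ n) x) 2 (volume.restrict Ω)).toReal ≤
        1 / ((n : ℝ) + 1) := ENNReal.toReal_le_of_le_ofReal (by positivity) (h2 n)
    have e4 : 1 / ((n : ℝ) + 1) ≤ 1 := by
      rw [div_le_one (by positivity)]; linarith [Nat.cast_nonneg (α := ℝ) n]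
    linarith [hC n]
  have hφ0 := IsTestFunction.tendsto_eLpNorm_zero hΩb hφ hbd (fun ψ hψ => by
    have e1 := tendsto_integral_inner_zero (fun _ : ℕ => hψ) hs1 (fun _ => le_rfl) h0
    have e2 := (hw ψ hψ).sub e1
    rw [sub_zero] at e2
    refine e2.congr fun n => ?_
    rw [← integral_sub]
    · congr 1
      ext x
      simp only [RCLike.inner_apply, conj_trivial]
      ring
    · simpa using integrable_inner_of_memLp hψ (h n).1
    · exact integrable_inner_of_memLp hψ (hs1 n))
  refine squeeze_zero (fun _ => ENNReal.toReal_nonneg) (fun n => ?_) (by simpa using h0.add hφ0)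
  have e : u n = (fun x => u n x - φ n x) + φ n := by ext x; simp
  have e1 := eLpNorm_add_le (hs1 n).1 ((hφ n).memLp 2 Ω).1 (p := 2) (by norm_num)
  rw [← e] at e1
  have e2 := ENNReal.toReal_mono (ENNReal.add_ne_top.2
    ⟨(hs1 n).eLpNorm_ne_top, ((hφ n).memLp 2 Ω).eLpNorm_ne_top⟩) e1
  rwa [ENNReal.toReal_add (hs1 n).eLpNorm_ne_top ((hφ n).memLp 2 Ω).eLpNorm_ne_top] at e2

end MemH10

/-! ### The Dirichlet problem -/

section Elliptic
variable {N : ℕ} {Ω : Set (EuclideanSpace ℝ (Fin N))}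
  {A : EuclideanSpace ℝ (Fin N) → Matrix (Fin N) (Fin N) ℝ}

theorem flux_add (G H : EuclideanSpace ℝ (Fin N) → EuclideanSpace ℝ (Fin N))
    {K : EuclideanSpace ℝ (Fin N) → EuclideanSpace ℝ (Fin N)} {x : EuclideanSpace ℝ (Fin N)}
    (h : K x = G x + H x) : flux A K x = flux A G x + flux A H x := by
  ext i
  simp [flux, h, mul_add, Finset.sum_add_distrib]

theorem flux_smul (c : ℝ) (G : EuclideanSpace ℝ (Fin N) → EuclideanSpace ℝ (Fin N))
    {K : EuclideanSpace ℝ (Fin N) → EuclideanSpace ℝ (Fin N)} {x : EuclideanSpace ℝ (Fin N)}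
    (h : K x = c • G x) : flux A K x = c • flux A G x := by
  ext i
  simp [flux, h, Finset.mul_sum, mul_left_comm]

theorem inner_flux (G : EuclideanSpace ℝ (Fin N) → EuclideanSpace ℝ (Fin N))
    (x y : EuclideanSpace ℝ (Fin N)) :
    inner ℝ (flux A G x) y = ∑ i, ∑ j, A x i j * y i * G x j := by
  simp [flux, PiLp.inner_apply, Finset.mul_sum, mul_left_comm, mul_assoc]

theorem norm_flux_le {b : ℝ} {x : EuclideanSpace ℝ (Fin N)} (hA : ∀ i j, |A x i j| ≤ b)
    (G : EuclideanSpace ℝ (Fin N) → EuclideanSpace ℝ (Fin N)) :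
    ‖flux A G x‖ ≤ (N * N * b) * ‖G x‖ := by
  have h1 : ∀ i, |flux A G x i| ≤ N * b * ‖G x‖ := fun i => by
    calc |∑ j, A x i j * G x j| ≤ ∑ j : Fin N, b * ‖G x‖ := by
          refine (Finset.abs_sum_le_sum_abs _ _).trans (Finset.sum_le_sum fun j _ => ?_)
          rw [abs_mul]
          exact mul_le_mul (hA i j) (PiLp.norm_apply_le (G x) j) (abs_nonneg _)
            ((abs_nonneg _).trans (hA i j))
      _ = _ := by simp [mul_assoc]
  have h2 : flux A G x = ∑ i, EuclideanSpace.single i (flux A G x i) := by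
    ext k
    simp [Finset.sum_apply, Pi.single_apply]
  rw [h2]
  refine (norm_sum_le _ _).trans ?_
  calc ∑ i, ‖EuclideanSpace.single i (flux A G x i)‖ ≤ ∑ i : Fin N, N * b * ‖G x‖ :=
        Finset.sum_le_sum fun i _ => by simpa using h1 i
    _ = _ := by simp [mul_assoc]

theorem aestronglyMeasurable_flux {ν : Measure (EuclideanSpace ℝ (Fin N))}
    (hA : ∀ i j, AEStronglyMeasurable (fun x => A x i j) ν)
    {G : EuclideanSpace ℝ (Fin N) → EuclideanSpace ℝ (Fin N)} (hG : AEStronglyMeasurable G ν) :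
    AEStronglyMeasurable (flux A G) ν := by
  have h1 : ∀ i, AEStronglyMeasurable (fun x => ∑ j, A x i j * G x j) ν := fun i =>
    Finset.aestronglyMeasurable_fun_sum _ fun j _ => (hA i j).mul
      ((EuclideanSpace.proj (𝕜 := ℝ) j).continuous.comp_aestronglyMeasurable hG)
  have h2 : AEStronglyMeasurable (fun x i => ∑ j, A x i j * G x j) ν :=
    (aemeasurable_pi_lambda _ fun i => (h1 i).aemeasurable).aestronglyMeasurable
  exact (PiLp.continuous_toLp 2 _).comp_aestronglyMeasurable h2

theorem memLp_flux {ν : Measure (EuclideanSpace ℝ (Fin N))} {b : ℝ}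
    (hA : ∀ i j, AEStronglyMeasurable (fun x => A x i j) ν)
    (hb : ∀ᵐ x ∂ν, ∀ i j, |A x i j| ≤ b)
    {G : EuclideanSpace ℝ (Fin N) → EuclideanSpace ℝ (Fin N)} (hG : MemLp G 2 ν) :
    MemLp (flux A G) 2 ν :=
  hG.of_le_mul (aestronglyMeasurable_flux hA hG.1)
    (by filter_upwards [hb] with x hx using norm_flux_le hx G)

/-- Multiplication by a bounded matrix field, as an operator on `L²`. -/
noncomputable def fluxCLM {ν : Measure (EuclideanSpace ℝ (Fin N))} {b : ℝ}
    (hA : ∀ i j, AEStronglyMeasurable (fun x => A x i j) ν)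
    (hb : ∀ᵐ x ∂ν, ∀ i j, |A x i j| ≤ b) :
    Lp (EuclideanSpace ℝ (Fin N)) 2 ν →L[ℝ] Lp (EuclideanSpace ℝ (Fin N)) 2 ν :=
  LinearMap.mkContinuous
    { toFun := fun g => (memLp_flux hA hb (Lp.memLp g)).toLp (flux A g)
      map_add' := fun g h => by
        rw [← MemLp.toLp_add, MemLp.toLp_eq_toLp_iff]
        filter_upwards [Lp.coeFn_add g h] with x hx using flux_add _ _ hx
      map_smul' := fun c g => by
        rw [RingHom.id_apply, ← MemLp.toLp_const_smul, MemLp.toLp_eq_toLp_iff]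
        filter_upwards [Lp.coeFn_smul c g] with x hx using flux_smul c _ hx }
    (N * N * b) (fun g => by
      refine Lp.norm_le_mul_norm_of_ae_le_mul ?_
      filter_upwards [hb, (memLp_flux hA hb (Lp.memLp g)).coeFn_toLp] with x hx h2
      simp only [LinearMap.coe_mk, AddHom.coe_mk]
      rw [h2]
      exact norm_flux_le hx _)

theorem coeFn_fluxCLM {ν : Measure (EuclideanSpace ℝ (Fin N))} {b : ℝ}
    (hA : ∀ i j, AEStronglyMeasurable (fun x => A x i j) ν)
    (hb : ∀ᵐ x ∂ν, ∀ i j, |A x i j| ≤ b) (g : Lp (EuclideanSpace ℝ (Fin N)) 2 ν) :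
    fluxCLM hA hb g =ᵐ[ν] flux A g :=
  (memLp_flux hA hb (Lp.memLp g)).coeFn_toLp

/-- `H¹₀(Ω)` as a subspace of the Hilbert space `L²(Ω) × L²(Ω; ℝ^N)`, an element of which is a
function together with its weak gradient. -/
noncomputable def H10 (Ω : Set (EuclideanSpace ℝ (Fin N))) :
    Submodule ℝ (WithLp 2 (Lp ℝ 2 (volume.restrict Ω) ×
      Lp (EuclideanSpace ℝ (Fin N)) 2 (volume.restrict Ω))) where
  carrier := {p | MemH10 Ω p.fst p.snd}
  add_mem' {p q} hp hq := (MemH10.add hp hq).congr_ae (Lp.coeFn_add p.fst q.fst).symm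
    (Lp.coeFn_add p.snd q.snd).symm
  zero_mem' := MemH10.zero.congr_ae (Lp.coeFn_zero _ _ _).symm (Lp.coeFn_zero _ _ _).symm
  smul_mem' c p hp := (MemH10.const_mul hp c).congr_ae (Lp.coeFn_smul c p.fst).symm
    (Lp.coeFn_smul c p.snd).symm

theorem isClosed_H10 : IsClosed (H10 Ω : Set (WithLp 2 (Lp ℝ 2 (volume.restrict Ω) ×
      Lp (EuclideanSpace ℝ (Fin N)) 2 (volume.restrict Ω)))) := by
  refine IsSeqClosed.isClosed fun p q hp hpq => ?_
  have h1 : Tendsto (fun n => (p n).fst) atTop (𝓝 q.fst) :=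
    ((WithLp.fstL 2 ℝ _ _).continuous.tendsto q).comp hpq
  have h2 : Tendsto (fun n => (p n).snd) atTop (𝓝 q.snd) :=
    ((WithLp.sndL 2 ℝ _ _).continuous.tendsto q).comp hpq
  rw [tendsto_iff_edist_tendsto_0] at h1 h2
  refine memH10_iff.2 ⟨Lp.memLp _, Lp.memLp _, fun ε hε => ?_⟩
  have hε2 : 0 < ε / 2 := ENNReal.half_pos hε.ne'
  obtain ⟨n, hn1, hn2⟩ := ((h1.eventually_le_const hε2).and (h2.eventually_le_const hε2)).exists
  obtain ⟨-, -, h⟩ := memH10_iff.1 (hp n)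
  obtain ⟨φ, hφ, h3, h4⟩ := h (ε / 2) hε2
  rw [edist_comm, Lp.edist_def] at hn1 hn2
  refine ⟨φ, hφ, ?_, ?_⟩
  · calc eLpNorm (fun x => q.fst x - φ x) 2 (volume.restrict Ω)
        = eLpNorm ((⇑q.fst - ⇑(p n).fst) + fun x => (p n).fst x - φ x) 2 (volume.restrict Ω) := by
          congr 1; ext x; simp
      _ ≤ _ := eLpNorm_add_le ((Lp.memLp _).sub (Lp.memLp _)).1
          ((Lp.memLp _).sub (hφ.memLp 2 Ω)).1 (by norm_num)
      _ ≤ ε / 2 + ε / 2 := add_le_add hn1 h3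
      _ = ε := ENNReal.add_halves ε
  · calc eLpNorm (fun x => q.snd x - gradient φ x) 2 (volume.restrict Ω)
        = eLpNorm ((⇑q.snd - ⇑(p n).snd) + fun x => (p n).snd x - gradient φ x) 2
            (volume.restrict Ω) := by
          congr 1; ext1 x; simp
      _ ≤ _ := eLpNorm_add_le ((Lp.memLp _).sub (Lp.memLp _)).1
          ((Lp.memLp _).sub (hφ.memLp_gradient 2 Ω)).1 (by norm_num)
      _ ≤ ε / 2 + ε / 2 := add_le_add hn2 h4
      _ = ε := ENNReal.add_halves ε

/-- The Lax–Milgram theorem in a closed subspace of a product on which the second component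
controls the first. -/
theorem exists_solution_of_coercive {X Y : Type*} [NormedAddCommGroup X] [InnerProductSpace ℝ X]
    [CompleteSpace X] [NormedAddCommGroup Y] [InnerProductSpace ℝ Y] [CompleteSpace Y]
    (K : Submodule ℝ (WithLp 2 (X × Y))) (hK : IsClosed (K : Set (WithLp 2 (X × Y))))
    (T : Y →L[ℝ] Y) {a C : ℝ} (ha : 0 < a)
    (hC : ∀ p ∈ K, ‖p.fst‖ ≤ C * ‖p.snd‖)
    (hT : ∀ p ∈ K, a * ‖p.snd‖ ^ 2 ≤ inner ℝ (T p.snd) p.snd) (x : X) (y : Y) :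
    ∃ p ∈ K, ∀ q ∈ K, inner ℝ (T p.snd) q.snd = inner ℝ x q.fst + inner ℝ y q.snd := by
  have hcomp : CompleteSpace K := hK.completeSpace_coe
  let S₁ : K →L[ℝ] X := (WithLp.fstL 2 ℝ X Y).comp K.subtypeL
  let S : K →L[ℝ] Y := (WithLp.sndL 2 ℝ X Y).comp K.subtypeL
  let B : K →L[ℝ] K →L[ℝ] ℝ := (innerSL ℝ).bilinearComp (T.comp S) S
  have hBc : IsCoercive B := by
    refine ⟨a / (C ^ 2 + 1), by positivity, fun p => ?_⟩
    have h1 : ‖p‖ ^ 2 ≤ (C ^ 2 + 1) * ‖S p‖ ^ 2 := by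
      have h2 : ‖S₁ p‖ ≤ C * ‖S p‖ := hC p p.2
      have h3 : ‖p‖ ^ 2 = ‖S₁ p‖ ^ 2 + ‖S p‖ ^ 2 := WithLp.prod_norm_sq_eq_of_L2 p.1
      have h4 := pow_le_pow_left₀ (norm_nonneg _) h2 2
      rw [mul_pow] at h4
      rw [h3]
      linarith
    have h5 : a * ‖S p‖ ^ 2 ≤ B p p := hT p p.2
    calc a / (C ^ 2 + 1) * ‖p‖ * ‖p‖ = a / (C ^ 2 + 1) * ‖p‖ ^ 2 := by ring
      _ ≤ a / (C ^ 2 + 1) * ((C ^ 2 + 1) * ‖S p‖ ^ 2) := by gcongr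
      _ = a * ‖S p‖ ^ 2 := by field_simp
      _ ≤ B p p := h5
  let l : K →L[ℝ] ℝ := (innerSL ℝ x).comp S₁ + (innerSL ℝ y).comp S
  let f := (InnerProductSpace.toDual ℝ K).symm l
  let p := hBc.continuousLinearEquivOfBilin.symm f
  refine ⟨p, p.2, fun q hq => ?_⟩
  have h1 : B p ⟨q, hq⟩ = l ⟨q, hq⟩ := by
    rw [← hBc.continuousLinearEquivOfBilin_apply, ContinuousLinearEquiv.apply_symm_apply]
    exact InnerProductSpace.toDual_symm_apply
  exact h1

/-- The Dirichlet problem `-div (A ∇p) = ψ - div F`, `p ∈ H¹₀(Ω)`, for a bounded coercive matrix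
field `A`. -/
theorem exists_dirichlet_solution [NeZero N] (hΩb : Bornology.IsBounded Ω) {a b : ℝ} (ha : 0 < a)
    (hA : ∀ i j, AEStronglyMeasurable (fun x => A x i j) (volume.restrict Ω))
    (hb : ∀ᵐ x ∂(volume.restrict Ω), ∀ i j, |A x i j| ≤ b)
    (hc : ∀ᵐ x ∂(volume.restrict Ω), ∀ ξ : EuclideanSpace ℝ (Fin N),
      a * ‖ξ‖ ^ 2 ≤ ∑ i, ∑ j, A x i j * ξ i * ξ j)
    {ψ : EuclideanSpace ℝ (Fin N) → ℝ} (hψ : MemLp ψ 2 (volume.restrict Ω))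
    {F : EuclideanSpace ℝ (Fin N) → EuclideanSpace ℝ (Fin N)}
    (hF : MemLp F 2 (volume.restrict Ω)) :
    ∃ p P, MemH10 Ω p P ∧ ∀ q Q, MemH10 Ω q Q →
      ∫ x in Ω, inner ℝ (flux A P x) (Q x) =
        (∫ x in Ω, ψ x * q x) + ∫ x in Ω, inner ℝ (F x) (Q x) := by
  obtain ⟨C, hC0, hC⟩ := exists_poincare_memH10 hΩb
  have hT : ∀ p : Lp (EuclideanSpace ℝ (Fin N)) 2 (volume.restrict Ω),
      a * ‖p‖ ^ 2 ≤ inner ℝ (fluxCLM hA hb p) p := fun p => by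
    have hp := Lp.memLp p
    have h : inner ℝ (fluxCLM hA hb p) p = ∫ x in Ω, inner ℝ (flux A p x) (p x) := by
      rw [L2.inner_def]
      refine integral_congr_ae ?_
      filter_upwards [coeFn_fluxCLM hA hb p] with x hx
      rw [hx]
    rw [h, Lp.norm_def, ← integral_norm_sq_eq hp, ← integral_const_mul]
    refine integral_mono_ae (hp.integrable_norm_pow (by norm_num) |>.const_mul a)
      (integrable_inner_of_memLp (memLp_flux hA hb hp) hp) ?_
    filter_upwards [hc] with x hx
    rw [inner_flux]
    exact hx _
  obtain ⟨p, hp, h⟩ := exists_solution_of_coercive (H10 Ω) isClosed_H10 (fluxCLM hA hb) ha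
    (fun p hp => by rw [Lp.norm_def, Lp.norm_def]; exact hC _ _ hp) (fun p _ => hT p.snd)
    (hψ.toLp ψ) (hF.toLp F)
  refine ⟨_, _, hp, fun q Q hq => ?_⟩
  have h2 := h (WithLp.toLp 2 (hq.1.toLp q, hq.2.1.toLp Q))
    (hq.congr_ae hq.1.coeFn_toLp.symm hq.2.1.coeFn_toLp.symm)
  simp only [WithLp.toLp_fst, WithLp.toLp_snd] at h2
  rw [inner_toLp_toLp, inner_toLp_toLp, L2.inner_def] at h2
  have h3 : ∫ x in Ω, ψ x * q x = ∫ x in Ω, inner ℝ (ψ x) (q x) := by simp [mul_comm]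
  rw [h3, ← h2]
  refine integral_congr_ae ?_
  filter_upwards [hq.2.1.coeFn_toLp, coeFn_fluxCLM hA hb p.snd] with x hx hx'
  rw [hx, hx']

end Elliptic

/-! ### Two-phase coefficients and the div-curl lemma -/

section Phase
variable {N : ℕ} {Ω : Set (EuclideanSpace ℝ (Fin N))}

/-- The scalar field equal to `c₁` in `ω` and to `c₀` outside. -/
noncomputable def phase (c₀ c₁ : ℝ) (ω : Set (EuclideanSpace ℝ (Fin N)))
    (x : EuclideanSpace ℝ (Fin N)) : ℝ :=
  c₁ * ω.indicator 1 x + c₀ * (1 - ω.indicator 1 x)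

theorem phase_of_mem {c₀ c₁ : ℝ} {ω : Set (EuclideanSpace ℝ (Fin N))}
    {x : EuclideanSpace ℝ (Fin N)} (hx : x ∈ ω) : phase c₀ c₁ ω x = c₁ := by
  simp [phase, hx]

theorem phase_of_notMem {c₀ c₁ : ℝ} {ω : Set (EuclideanSpace ℝ (Fin N))}
    {x : EuclideanSpace ℝ (Fin N)} (hx : x ∉ ω) : phase c₀ c₁ ω x = c₀ := by
  simp [phase, hx]

theorem measurable_phase (c₀ c₁ : ℝ) {ω : Set (EuclideanSpace ℝ (Fin N))}
    (hω : MeasurableSet ω) : Measurable (phase c₀ c₁ ω) := by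
  have : Measurable (ω.indicator (1 : EuclideanSpace ℝ (Fin N) → ℝ)) :=
    measurable_one.indicator hω
  exact (this.const_mul c₁).add ((measurable_const.sub this).const_mul c₀)

theorem min_le_phase (c₀ c₁ : ℝ) (ω : Set (EuclideanSpace ℝ (Fin N)))
    (x : EuclideanSpace ℝ (Fin N)) : min c₀ c₁ ≤ phase c₀ c₁ ω x := by
  by_cases hx : x ∈ ω
  · simp [phase_of_mem hx]
  · simp [phase_of_notMem hx]

theorem phase_le_max (c₀ c₁ : ℝ) (ω : Set (EuclideanSpace ℝ (Fin N)))
    (x : EuclideanSpace ℝ (Fin N)) : phase c₀ c₁ ω x ≤ max c₀ c₁ := by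
  by_cases hx : x ∈ ω
  · simp [phase_of_mem hx]
  · simp [phase_of_notMem hx]

theorem norm_phase_le {c₀ c₁ : ℝ} (h₀ : 0 < c₀) (h₁ : 0 < c₁)
    (ω : Set (EuclideanSpace ℝ (Fin N))) (x : EuclideanSpace ℝ (Fin N)) :
    ‖phase c₀ c₁ ω x‖ ≤ max c₀ c₁ := by
  rw [Real.norm_of_nonneg ((lt_min h₀ h₁).le.trans (min_le_phase c₀ c₁ ω x))]
  exact phase_le_max c₀ c₁ ω x

theorem flux_twoPhase (γ₀ γ₁ : ℝ) (ω : Set (EuclideanSpace ℝ (Fin N)))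
    (G : EuclideanSpace ℝ (Fin N) → EuclideanSpace ℝ (Fin N)) (x : EuclideanSpace ℝ (Fin N)) :
    flux (twoPhase γ₀ γ₁ ω) G x = phase γ₀ γ₁ ω x • G x := by
  ext i
  simp [flux, twoPhase, phase, Matrix.one_apply]

theorem memLp_flux_twoPhase {γ₀ γ₁ : ℝ} (h₀ : 0 < γ₀) (h₁ : 0 < γ₁)
    {ω : Set (EuclideanSpace ℝ (Fin N))} (hω : MeasurableSet ω)
    {G : EuclideanSpace ℝ (Fin N) → EuclideanSpace ℝ (Fin N)}
    (hG : MemLp G 2 (volume.restrict Ω)) :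
    MemLp (flux (twoPhase γ₀ γ₁ ω) G) 2 (volume.restrict Ω) := by
  simp only [funext (flux_twoPhase γ₀ γ₁ ω G)]
  exact memLp_two_mul_of_bound (measurable_phase γ₀ γ₁ hω).aestronglyMeasurable
    (ae_of_all _ (norm_phase_le h₀ h₁ ω)) hG

theorem eLpNorm_flux_twoPhase_le {γ₀ γ₁ : ℝ} (h₀ : 0 < γ₀) (h₁ : 0 < γ₁)
    (ω : Set (EuclideanSpace ℝ (Fin N)))
    {G : EuclideanSpace ℝ (Fin N) → EuclideanSpace ℝ (Fin N)}
    (hG : MemLp G 2 (volume.restrict Ω)) :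
    (eLpNorm (flux (twoPhase γ₀ γ₁ ω) G) 2 (volume.restrict Ω)).toReal ≤
      max γ₀ γ₁ * (eLpNorm G 2 (volume.restrict Ω)).toReal := by
  simp only [funext (flux_twoPhase γ₀ γ₁ ω G)]
  exact eLpNorm_smul_le_of_bound (ae_of_all _ (norm_phase_le h₀ h₁ ω)) hG

theorem exists_dirichlet_solution_twoPhase [NeZero N] (hΩb : Bornology.IsBounded Ω)
    {γ₀ γ₁ : ℝ} (h₀ : 0 < γ₀) (h₁ : 0 < γ₁)
    {ω : Set (EuclideanSpace ℝ (Fin N))} (hω : MeasurableSet ω)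
    {F : EuclideanSpace ℝ (Fin N) → EuclideanSpace ℝ (Fin N)}
    (hF : MemLp F 2 (volume.restrict Ω)) :
    ∃ u G, MemH10 Ω u G ∧ SolvesWeakly Ω (twoPhase γ₀ γ₁ ω) G F := by
  obtain ⟨u, G, hu, h⟩ := exists_dirichlet_solution (A := twoPhase γ₀ γ₁ ω) hΩb (lt_min h₀ h₁)
    (b := max γ₀ γ₁)
    (fun i j => ((measurable_phase γ₀ γ₁ hω).mul_const _).aestronglyMeasurable)
    (ae_of_all _ fun x i j => by
      have := norm_phase_le h₀ h₁ ω x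
      by_cases hij : i = j
      · simpa [twoPhase, phase, hij] using this
      · simp [twoPhase, hij, h₀.le])
    (ae_of_all _ fun x ξ => by
      have h2 : ∑ i, ∑ j, twoPhase γ₀ γ₁ ω x i j * ξ i * ξ j = phase γ₀ γ₁ ω x * ‖ξ‖ ^ 2 := by
        rw [← inner_flux (fun _ => ξ), flux_twoPhase, real_inner_smul_left,
          real_inner_self_eq_norm_sq]
      rw [h2]
      exact mul_le_mul_of_nonneg_right (min_le_phase γ₀ γ₁ ω x) (sq_nonneg _))
    (MemLp.zero (p := 2)) hF
  refine ⟨u, G, hu, fun φ hφ => ?_⟩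
  simpa using h φ _ hφ.memH10

end Phase

namespace IsConductivity
variable {N : ℕ} {Ω : Set (EuclideanSpace ℝ (Fin N))} {a b : ℝ}
  {B : EuclideanSpace ℝ (Fin N) → Matrix (Fin N) (Fin N) ℝ}

/-- The entries of a symmetric matrix `0 ≤ B ≤ b I` are bounded by `b`: test with `e_i ± e_j`. -/
theorem ae_abs_le (ha : 0 ≤ a) (hB : IsConductivity a b Ω B) :
    ∀ᵐ x ∂(volume.restrict Ω), ∀ i j, |B x i j| ≤ b := by
  filter_upwards [hB.2] with x hx i j
  obtain ⟨hs, hq⟩ := hx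
  have hbil : ∀ c : ℝ, 0 ≤ B x i i + c * B x i j + c * B x j i + c * c * B x j j := fun c => by
    obtain ⟨ζ, hζ⟩ : ∃ ζ : EuclideanSpace ℝ (Fin N), ∀ k, ζ k =
        (if k = i then 1 else 0) + c * (if k = j then 1 else 0) :=
      ⟨WithLp.toLp 2 fun k => (if k = i then 1 else 0) + c * (if k = j then 1 else 0),
        fun _ => rfl⟩
    have h := (hq ζ).1
    have h' : ∑ k, ∑ l, B x k l * ζ k * ζ l =
        B x i i + c * B x i j + c * B x j i + c * c * B x j j := by
      simp [hζ, mul_add, add_mul, Finset.sum_add_distrib]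
      ring
    rw [h'] at h
    exact (by positivity : (0 : ℝ) ≤ _).trans h
  have hdiag : ∀ k, B x k k ≤ b := fun k => by
    have h := (hq (EuclideanSpace.single k 1)).2
    simpa [Pi.single_apply] using h
  have h1 := hbil 1
  have h2 := hbil (-1)
  have h3 := hdiag i
  have h4 := hdiag j
  have h5 : B x j i = B x i j := hs.apply i j
  rw [abs_le]
  constructor <;> linarith

theorem memLp_flux (ha : 0 ≤ a) (hB : IsConductivity a b Ω B)
    {G : EuclideanSpace ℝ (Fin N) → EuclideanSpace ℝ (Fin N)}
    (hG : MemLp G 2 (volume.restrict Ω)) : MemLp (flux B G) 2 (volume.restrict Ω) :=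
  _root_.memLp_flux hB.1 (hB.ae_abs_le ha) hG

theorem ae_inner_flux_comm (hB : IsConductivity a b Ω B)
    (G H : EuclideanSpace ℝ (Fin N) → EuclideanSpace ℝ (Fin N)) :
    ∀ᵐ x ∂(volume.restrict Ω), inner ℝ (flux B G x) (H x) = inner ℝ (flux B H x) (G x) := by
  filter_upwards [hB.2] with x hx
  rw [inner_flux, inner_flux, Finset.sum_comm]
  refine Finset.sum_congr rfl fun i _ => Finset.sum_congr rfl fun j _ => ?_
  rw [hx.1.apply i j]
  ring

theorem exists_dirichlet_solution [NeZero N] (hΩb : Bornology.IsBounded Ω) (ha : 0 < a)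
    (hB : IsConductivity a b Ω B) {ψ : EuclideanSpace ℝ (Fin N) → ℝ}
    (hψ : MemLp ψ 2 (volume.restrict Ω))
    {F : EuclideanSpace ℝ (Fin N) → EuclideanSpace ℝ (Fin N)}
    (hF : MemLp F 2 (volume.restrict Ω)) :
    ∃ p P, MemH10 Ω p P ∧ ∀ q Q, MemH10 Ω q Q →
      ∫ x in Ω, inner ℝ (flux B P x) (Q x) =
        (∫ x in Ω, ψ x * q x) + ∫ x in Ω, inner ℝ (F x) (Q x) :=
  _root_.exists_dirichlet_solution hΩb ha hB.1 (hB.ae_abs_le ha.le)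
    (by filter_upwards [hB.2] with x hx ξ using (hx.2 ξ).1) hψ hF

end IsConductivity

section DivCurl
variable {N : ℕ} {Ω : Set (EuclideanSpace ℝ (Fin N))}

/-- A div-curl lemma: the fields `D n` have a fixed divergence `div F`, the fields `X n = ∇(s n)`
are gradients (locally), and `s n → s₀` strongly in `L²`. -/
theorem tendsto_integral_div_curl
    {D X : ℕ → EuclideanSpace ℝ (Fin N) → EuclideanSpace ℝ (Fin N)}
    {F X₀ : EuclideanSpace ℝ (Fin N) → EuclideanSpace ℝ (Fin N)}
    {s : ℕ → EuclideanSpace ℝ (Fin N) → ℝ} {s₀ : EuclideanSpace ℝ (Fin N) → ℝ} {C : ℝ}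
    (hD : ∀ n, MemLp (D n) 2 (volume.restrict Ω))
    (hDC : ∀ n, (eLpNorm (D n) 2 (volume.restrict Ω)).toReal ≤ C)
    (hF : MemLp F 2 (volume.restrict Ω))
    (hdiv : ∀ n, ∀ φ : EuclideanSpace ℝ (Fin N) → ℝ, IsTestFunction Ω φ →
      ∫ x in Ω, inner ℝ (D n x) (gradient φ x) = ∫ x in Ω, inner ℝ (F x) (gradient φ x))
    (hs : ∀ n, MemLp (s n) 2 (volume.restrict Ω)) (hs₀ : MemLp s₀ 2 (volume.restrict Ω))
    (hX : ∀ n, MemLp (X n) 2 (volume.restrict Ω))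
    (hcurl : ∀ n, ∀ φ : EuclideanSpace ℝ (Fin N) → ℝ, IsTestFunction Ω φ →
      MemH10 Ω (fun x => φ x * s n x) (fun x => φ x • X n x + s n x • gradient φ x))
    (hlim : Tendsto (fun n => (eLpNorm (fun x => s n x - s₀ x) 2 (volume.restrict Ω)).toReal)
      atTop (𝓝 0))
    (hXw : WeakTendstoL2 Ω X X₀) {φ : EuclideanSpace ℝ (Fin N) → ℝ} (hφ : IsTestFunction Ω φ) :
    Tendsto (fun n => (∫ x in Ω, φ x * inner ℝ (D n x) (X n x)) +
        ∫ x in Ω, inner ℝ (D n x) (s₀ x • gradient φ x)) atTop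
      (𝓝 ((∫ x in Ω, φ x * inner ℝ (F x) (X₀ x)) +
        ∫ x in Ω, inner ℝ (F x) (s₀ x • gradient φ x))) := by
  obtain ⟨K, hK0, hK⟩ := hφ.exists_bound
  obtain ⟨K', hK0', hK'⟩ := hφ.exists_bound_gradient
  have hφm := hφ.1.continuous.aestronglyMeasurable (μ := volume.restrict Ω)
  have hgm := (contDiff_gradient hφ.1).continuous.aestronglyMeasurable (μ := volume.restrict Ω)
  have hsφ : ∀ n, MemLp (fun x => s n x • gradient φ x) 2 (volume.restrict Ω) :=
    fun n => memLp_smul_of_norm_le (hs n) hgm hK'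
  have hs₀φ : MemLp (fun x => s₀ x • gradient φ x) 2 (volume.restrict Ω) :=
    memLp_smul_of_norm_le hs₀ hgm hK'
  have hXφ : ∀ n, MemLp (fun x => φ x • X n x) 2 (volume.restrict Ω) :=
    fun n => memLp_two_mul_of_bound hφm (ae_of_all _ hK) (hX n)
  have hd : ∀ n, MemLp (fun x => (s n x - s₀ x) • gradient φ x) 2 (volume.restrict Ω) :=
    fun n => memLp_smul_of_norm_le ((hs n).sub hs₀) hgm hK'
  have hd0 := tendsto_eLpNorm_smul_zero (g := gradient φ) (fun n => (hs n).sub hs₀) hK0' hK' hlim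
  have h1 := tendsto_integral_inner_zero hD hd hDC hd0
  have h2 := tendsto_integral_inner_zero (fun _ : ℕ => hF) hd (fun _ => le_rfl) hd0
  have h3 := hXw (fun x => φ x • F x) (memLp_two_mul_of_bound hφm (ae_of_all _ hK) hF)
  have h4 := ((h3.add h2).sub h1).add_const (∫ x in Ω, inner ℝ (F x) (s₀ x • gradient φ x))
  have split : ∀ {K : EuclideanSpace ℝ (Fin N) → EuclideanSpace ℝ (Fin N)} (n : ℕ),
      MemLp K 2 (volume.restrict Ω) →
      ∫ x in Ω, inner ℝ (K x) (φ x • X n x + s n x • gradient φ x) =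
      (∫ x in Ω, φ x * inner ℝ (K x) (X n x)) +
        ((∫ x in Ω, inner ℝ (K x) ((s n x - s₀ x) • gradient φ x)) +
        ∫ x in Ω, inner ℝ (K x) (s₀ x • gradient φ x)) := fun {K} n hKm => by
    rw [← integral_add (integrable_inner_of_memLp hKm (hd n))
      (integrable_inner_of_memLp hKm hs₀φ), ← integral_add]
    · congr 1
      ext x
      rw [inner_add_right, real_inner_smul_right, ← inner_add_right, ← add_smul, sub_add_cancel]
    · simpa only [real_inner_smul_right] using integrable_inner_of_memLp hKm (hXφ n)
    · exact (integrable_inner_of_memLp hKm (hd n)).add (integrable_inner_of_memLp hKm hs₀φ)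
  have h5 : ∀ {X : EuclideanSpace ℝ (Fin N) → EuclideanSpace ℝ (Fin N)},
      ∫ x in Ω, inner ℝ (X x) (φ x • F x) = ∫ x in Ω, φ x * inner ℝ (F x) (X x) := fun {X} => by
    congr 1
    ext x
    rw [real_inner_smul_right, real_inner_comm]
  simp only [h5, add_zero, sub_zero] at h4
  refine h4.congr fun n => ?_
  have h6 := (hcurl n φ hφ).integral_inner_eq (hD n) hF (hdiv n)
  rw [split n (hD n), split n hF] at h6
  linarith

end DivCurl

/-! ### Weak convergence of the correctors -/

section Correctors
variable {N : ℕ} {Ω : Set (EuclideanSpace ℝ (Fin N))}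

theorem isFiniteMeasure_restrict_of_isBounded (hΩb : Bornology.IsBounded Ω) :
    IsFiniteMeasure ((volume : Measure (EuclideanSpace ℝ (Fin N))).restrict Ω) :=
  ⟨by simpa using hΩb.measure_lt_top⟩

theorem memLp_const_of_isBounded (hΩb : Bornology.IsBounded Ω) {V : Type*} [NormedAddCommGroup V]
    (c : V) : MemLp (fun _ : EuclideanSpace ℝ (Fin N) => c) 2 (volume.restrict Ω) := by
  have := isFiniteMeasure_restrict_of_isBounded hΩb
  exact memLp_const c

theorem memLp_inner_of_isBounded (hΩ : IsOpen Ω) (hΩb : Bornology.IsBounded Ω)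
    (ξ : EuclideanSpace ℝ (Fin N)) :
    MemLp (fun x : EuclideanSpace ℝ (Fin N) => (inner ℝ ξ x : ℝ)) 2 (volume.restrict Ω) := by
  have := isFiniteMeasure_restrict_of_isBounded hΩb
  obtain ⟨R, hR⟩ := hΩb.exists_norm_le
  have hm : AEStronglyMeasurable (fun x : EuclideanSpace ℝ (Fin N) => (inner ℝ ξ x : ℝ))
      (volume.restrict Ω) := (by fun_prop : Continuous _).aestronglyMeasurable
  exact MemLp.of_bound hm (‖ξ‖ * R) (ae_restrict_of_forall_mem hΩ.measurableSet fun x hx =>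
    (norm_inner_le_norm ξ x).trans (mul_le_mul_of_nonneg_left (hR x hx) (norm_nonneg ξ)))

theorem contDiff_inner_const (ξ : EuclideanSpace ℝ (Fin N)) :
    ContDiff ℝ ((⊤ : ℕ∞) : WithTop ℕ∞)
      (fun x : EuclideanSpace ℝ (Fin N) => (inner ℝ ξ x : ℝ)) := (innerSL ℝ ξ).contDiff

/-- `z + ⟨ξ, ·⟩`, with gradient `X`, is the corrector in the direction `ξ`: the solution of
`-div (A X) = -div (B ξ)` in `Ω` with boundary values `⟨ξ, x⟩`. -/
def IsCorrectorAlong (Ω : Set (EuclideanSpace ℝ (Fin N)))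
    (A B : EuclideanSpace ℝ (Fin N) → Matrix (Fin N) (Fin N) ℝ) (ξ : EuclideanSpace ℝ (Fin N))
    (z : EuclideanSpace ℝ (Fin N) → ℝ) (X : EuclideanSpace ℝ (Fin N) → EuclideanSpace ℝ (Fin N)) :
    Prop :=
  MemH10 Ω z (fun x => X x - ξ) ∧ SolvesWeakly Ω A X (flux B fun _ => ξ)

namespace IsCorrectorAlong

variable {A B : EuclideanSpace ℝ (Fin N) → Matrix (Fin N) (Fin N) ℝ} {ξ : EuclideanSpace ℝ (Fin N)}
  {z : EuclideanSpace ℝ (Fin N) → ℝ} {X : EuclideanSpace ℝ (Fin N) → EuclideanSpace ℝ (Fin N)}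

theorem memLp (hΩb : Bornology.IsBounded Ω) (h : IsCorrectorAlong Ω A B ξ z X) :
    MemLp X 2 (volume.restrict Ω) := by
  have := h.1.2.1.add (memLp_const_of_isBounded hΩb ξ)
  refine this.ae_eq (ae_of_all _ fun x => ?_)
  simp

theorem test_mul (h : IsCorrectorAlong Ω A B ξ z X) {φ : EuclideanSpace ℝ (Fin N) → ℝ}
    (hφ : IsTestFunction Ω φ) :
    MemH10 Ω (fun x => φ x * (inner ℝ ξ x + z x))
      (fun x => φ x • X x + (inner ℝ ξ x + z x) • gradient φ x) := by
  refine ((hφ.mul_contDiff (contDiff_inner_const ξ)).memH10.add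
    (h.1.test_mul hφ)).congr_ae (ae_of_all _ fun x => ?_) (ae_of_all _ fun x => ?_)
  · simp only; ring
  · simp only
    rw [gradient_mul hφ.differentiable.differentiableAt
      ((contDiff_inner_const ξ).differentiable (by simp)).differentiableAt, gradient_inner_const,
      smul_sub, add_smul]
    abel

end IsCorrectorAlong

/-- The corrector in the direction `ξ` is the combination of the coordinate correctors with the
coordinates of `ξ`. -/
theorem IsCorrector.along {A B : EuclideanSpace ℝ (Fin N) → Matrix (Fin N) (Fin N) ℝ}
    {w : Fin N → EuclideanSpace ℝ (Fin N) → ℝ}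
    {W : Fin N → EuclideanSpace ℝ (Fin N) → EuclideanSpace ℝ (Fin N)}
    (h : IsCorrector Ω A B w W)
    (hA : ∀ G, MemLp G 2 (volume.restrict Ω) → MemLp (flux A G) 2 (volume.restrict Ω))
    (hB : ∀ G, MemLp G 2 (volume.restrict Ω) → MemLp (flux B G) 2 (volume.restrict Ω))
    (hΩb : Bornology.IsBounded Ω) (ξ : EuclideanSpace ℝ (Fin N)) :
    IsCorrectorAlong Ω A B ξ (fun x => ∑ i, ξ i * (w i x - x i)) (fun x => ∑ i, ξ i • W i x) := by
  have hξ : ξ = ∑ i, ξ i • EuclideanSpace.single i (1 : ℝ) := by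
    ext k
    simp [Finset.sum_apply, Pi.single_apply]
  have hW : ∀ i, MemLp (W i) 2 (volume.restrict Ω) := fun i => by
    refine ((h i).1.2.1.add (memLp_const_of_isBounded hΩb (EuclideanSpace.single i 1))).ae_eq
      (ae_of_all _ fun x => ?_)
    simp
  have hflux : ∀ (K : EuclideanSpace ℝ (Fin N) → Matrix (Fin N) (Fin N) ℝ)
      (V : Fin N → EuclideanSpace ℝ (Fin N) → EuclideanSpace ℝ (Fin N)) x,
      flux K (fun x => ∑ i, ξ i • V i x) x = ∑ i, ξ i • flux K (V i) x := fun K V x => by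
    ext k
    simp only [flux, WithLp.ofLp_sum, WithLp.ofLp_smul, Finset.sum_apply, Pi.smul_apply,
      smul_eq_mul, Finset.mul_sum]
    rw [Finset.sum_comm]
    refine Finset.sum_congr rfl fun i _ => Finset.sum_congr rfl fun j _ => ?_
    ring
  refine ⟨(MemH10.finset_sum Finset.univ fun i _ => (h i).1.const_mul (ξ i)).congr_ae
    (ae_of_all _ fun x => rfl) (ae_of_all _ fun x => ?_), fun φ hφ => ?_⟩
  · simp only [smul_sub, Finset.sum_sub_distrib]
    rw [← hξ]
  · have hB' : ∀ x, flux B (fun _ => ξ) x =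
        ∑ i, ξ i • flux B (fun _ => EuclideanSpace.single i 1) x := fun x => by
      rw [← hflux]
      conv_lhs => rw [hξ]
    simp only [hflux, hB', sum_inner, real_inner_smul_left]
    rw [integral_finsetSum, integral_finsetSum]
    · refine Finset.sum_congr rfl fun i _ => ?_
      rw [integral_const_mul, integral_const_mul, (h i).2 φ hφ]
    · exact fun i _ => (integrable_inner_of_memLp (hB _ (memLp_const_of_isBounded hΩb _))
        (hφ.memLp_gradient 2 Ω)).const_mul _
    · exact fun i _ => (integrable_inner_of_memLp (hA _ (hW i)) (hφ.memLp_gradient 2 Ω)).const_mul _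

end Correctors

section CorrectorLimits
variable {N : ℕ} {Ω : Set (EuclideanSpace ℝ (Fin N))} {γ₀ γ₁ : ℝ}
  {ω : ℕ → Set (EuclideanSpace ℝ (Fin N))}
  {B : EuclideanSpace ℝ (Fin N) → Matrix (Fin N) (Fin N) ℝ} {ξ : EuclideanSpace ℝ (Fin N)}
  {z : ℕ → EuclideanSpace ℝ (Fin N) → ℝ}
  {X : ℕ → EuclideanSpace ℝ (Fin N) → EuclideanSpace ℝ (Fin N)}

theorem WeakTendstoL2.sub_const {V : Type*} [NormedAddCommGroup V] [InnerProductSpace ℝ V]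
    {f : ℕ → EuclideanSpace ℝ (Fin N) → V} {g : EuclideanSpace ℝ (Fin N) → V}
    (h : WeakTendstoL2 Ω f g) (hf : ∀ n, MemLp (f n) 2 (volume.restrict Ω))
    (hg : MemLp g 2 (volume.restrict Ω)) :
    WeakTendstoL2 Ω (fun n x => f n x - g x) (fun _ => 0) := by
  intro ψ hψ
  have := (h ψ hψ).sub_const (∫ x in Ω, inner ℝ (g x) (ψ x))
  simp only [sub_self] at this
  simp only [inner_zero_left, integral_zero, inner_sub_left]
  refine this.congr fun n => ?_
  rw [integral_sub (integrable_inner_of_memLp (hf n) hψ) (integrable_inner_of_memLp hg hψ)]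

/-- Weak convergence in `H¹₀(Ω)` implies strong convergence in `L²` (Rellich). -/
theorem tendsto_eLpNorm_sub_of_weak [NeZero N] (hΩb : Bornology.IsBounded Ω)
    {u : ℕ → EuclideanSpace ℝ (Fin N) → ℝ} {v : EuclideanSpace ℝ (Fin N) → ℝ}
    {G : ℕ → EuclideanSpace ℝ (Fin N) → EuclideanSpace ℝ (Fin N)}
    {H : EuclideanSpace ℝ (Fin N) → EuclideanSpace ℝ (Fin N)}
    (hu : ∀ n, MemH10 Ω (u n) (G n)) (hv : MemH10 Ω v H)
    (huw : WeakTendstoL2 Ω u v) (hGw : WeakTendstoL2 Ω G H) :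
    Tendsto (fun n => (eLpNorm (fun x => u n x - v x) 2 (volume.restrict Ω)).toReal)
      atTop (𝓝 0) := by
  have hG0 := hGw.sub_const (fun n => (hu n).2.1) hv.2.1
  have hu0 := huw.sub_const (fun n => (hu n).1) hv.1
  obtain ⟨C, -, hC⟩ := exists_eLpNorm_le_of_weak (fun n => ((hu n).sub hv).2.1) hG0
  refine MemH10.tendsto_eLpNorm_zero hΩb (fun n => (hu n).sub hv) hC fun ψ hψ => ?_
  simpa [mul_comm] using hu0 ψ hψ

/-- The gradients of the correctors converge weakly to `ξ`. By symmetry of the coefficients, the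
pairing of `X n - ξ` with an arbitrary field `F` is expressed through the solutions with
right-hand side `F`, to which H-convergence applies. -/
theorem IsCorrectorAlong.weakTendsto [NeZero N] (hΩb : Bornology.IsBounded Ω)
    (h₀ : 0 < γ₀) (h₁ : 0 < γ₁) (hωm : ∀ n, MeasurableSet (ω n))
    (hB : IsConductivity (min γ₀ γ₁) (max γ₀ γ₁) Ω B)
    (hH : HConverges Ω (fun n => twoPhase γ₀ γ₁ (ω n)) B)
    (h : ∀ n, IsCorrectorAlong Ω (twoPhase γ₀ γ₁ (ω n)) B ξ (z n) (X n)) :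
    WeakTendstoL2 Ω (fun n x => X n x - ξ) (fun _ => 0) := by
  intro F hF
  have hmin : 0 < min γ₀ γ₁ := lt_min h₀ h₁
  have hξ := memLp_const_of_isBounded hΩb ξ
  have hBξ := hB.memLp_flux hmin.le hξ
  choose u G hu hsol using fun n => exists_dirichlet_solution_twoPhase hΩb h₀ h₁ (hωm n) hF
  obtain ⟨v, H, hv, hvs⟩ := hB.exists_dirichlet_solution hΩb hmin
    (ψ := fun _ => (0 : ℝ)) (MemLp.zero (p := 2)) hF
  have hvs' : SolvesWeakly Ω B H F := fun φ hφ => by simpa using hvs _ _ hφ.memH10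
  obtain ⟨-, hG, hD⟩ := hH F hF u G v H (fun n => ⟨hu n, hsol n⟩) hv hvs'
  have hDm : ∀ n, MemLp (flux (twoPhase γ₀ γ₁ (ω n)) (G n)) 2 (volume.restrict Ω) :=
    fun n => memLp_flux_twoPhase h₀ h₁ (hωm n) (hu n).2.1
  have hXm := fun n => (h n).memLp hΩb
  have key : ∀ n, ∫ x in Ω, inner ℝ (X n x - ξ) (F x) =
      (∫ x in Ω, inner ℝ (G n x) (flux B (fun _ => ξ) x)) -
        ∫ x in Ω, inner ℝ (flux (twoPhase γ₀ γ₁ (ω n)) (G n) x) ξ := fun n => by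
    have e1 := (h n).1.integral_inner_eq (hDm n) hF (hsol n)
    have e2 := (hu n).integral_inner_eq (memLp_flux_twoPhase h₀ h₁ (hωm n) (hXm n)) hBξ (h n).2
    calc ∫ x in Ω, inner ℝ (X n x - ξ) (F x) = ∫ x in Ω, inner ℝ (F x) (X n x - ξ) := by
          simp only [real_inner_comm]
      _ = ∫ x in Ω, inner ℝ (flux (twoPhase γ₀ γ₁ (ω n)) (G n) x) (X n x - ξ) := e1.symm
      _ = (∫ x in Ω, inner ℝ (flux (twoPhase γ₀ γ₁ (ω n)) (G n) x) (X n x)) -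
          ∫ x in Ω, inner ℝ (flux (twoPhase γ₀ γ₁ (ω n)) (G n) x) ξ := by
          rw [← integral_sub (integrable_inner_of_memLp (hDm n) (hXm n))
            (integrable_inner_of_memLp (hDm n) hξ)]
          simp only [inner_sub_right]
      _ = _ := by
          congr 1
          calc _ = ∫ x in Ω, inner ℝ (flux (twoPhase γ₀ γ₁ (ω n)) (X n) x) (G n x) := by
                congr 1
                ext x
                rw [flux_twoPhase, flux_twoPhase, real_inner_smul_left, real_inner_smul_left,
                  real_inner_comm]
            _ = _ := by
                rw [e2]
                simp only [real_inner_comm]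
  simp only [key, inner_zero_left, integral_zero]
  have hlim := (hG _ hBξ).sub (hD _ hξ)
  have hzero : ∫ x in Ω, inner ℝ (H x) (flux B (fun _ => ξ) x) =
      ∫ x in Ω, inner ℝ (flux B H x) ξ := by
    refine integral_congr_ae ?_
    filter_upwards [hB.ae_inner_flux_comm H (fun _ => ξ)] with x hx
    rw [hx, real_inner_comm]
  rwa [hzero, sub_self] at hlim

/-- The correctors converge strongly in `L²` to the linear function `⟨ξ, ·⟩`. -/
theorem IsCorrectorAlong.tendsto_eLpNorm_zero [NeZero N] (hΩb : Bornology.IsBounded Ω)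
    (h₀ : 0 < γ₀) (h₁ : 0 < γ₁) (hωm : ∀ n, MeasurableSet (ω n))
    (hB : IsConductivity (min γ₀ γ₁) (max γ₀ γ₁) Ω B)
    (hH : HConverges Ω (fun n => twoPhase γ₀ γ₁ (ω n)) B)
    (h : ∀ n, IsCorrectorAlong Ω (twoPhase γ₀ γ₁ (ω n)) B ξ (z n) (X n)) :
    Tendsto (fun n => (eLpNorm (z n) 2 (volume.restrict Ω)).toReal) atTop (𝓝 0) := by
  have hmin : 0 < min γ₀ γ₁ := lt_min h₀ h₁
  have hw := IsCorrectorAlong.weakTendsto hΩb h₀ h₁ hωm hB hH h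
  obtain ⟨C, -, hC⟩ := exists_eLpNorm_le_of_weak (fun n => (h n).1.2.1) hw
  refine MemH10.tendsto_eLpNorm_zero hΩb (fun n => (h n).1) hC fun ψ hψ => ?_
  -- The functional `q ↦ ∫ ψ q` is represented as `∫ ⟨B P, ∇q⟩`.
  obtain ⟨p, P, hp, hP⟩ := hB.exists_dirichlet_solution hΩb hmin hψ
    (F := fun _ => (0 : EuclideanSpace ℝ (Fin N))) (MemLp.zero (p := 2))
  have h2 := hw _ (hB.memLp_flux hmin.le hp.2.1)
  simp only [inner_zero_left, integral_zero] at h2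
  refine h2.congr fun n => ?_
  have h3 := hP _ _ (h n).1
  simp only [inner_zero_left, integral_zero, add_zero] at h3
  simp only [mul_comm (z n _), ← h3, real_inner_comm]

end CorrectorLimits

/-! ### Convergence of fluxes and energies -/

section Cutoff
variable {N : ℕ} {Ω : Set (EuclideanSpace ℝ (Fin N))}

theorem exists_isTestFunction_eq_one {K U : Set (EuclideanSpace ℝ (Fin N))} (hK : IsCompact K)
    (hU : IsOpen U) (hKU : K ⊆ U) :
    ∃ χ : EuclideanSpace ℝ (Fin N) → ℝ, IsTestFunction U χ ∧ (∀ x ∈ K, ∀ᶠ y in 𝓝 x, χ y = 1) ∧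
      ∀ x, χ x ∈ Set.Icc (0 : ℝ) 1 := by
  obtain ⟨L, hL, hKL, hLU⟩ := exists_compact_between hK hU hKU
  obtain ⟨f, h1, h2, h3⟩ := exists_contMDiffMap_one_nhds_of_subset_interior (n := (⊤ : ℕ∞))
    (modelWithCornersSelf ℝ (EuclideanSpace ℝ (Fin N))) hK.isClosed hKL
  have hs : tsupport f ⊆ L := closure_minimal (fun x hx => by
    by_contra hxL
    exact hx (h2 x hxL)) hL.isClosed
  exact ⟨f, ⟨f.contMDiff.contDiff, hL.of_isClosed_subset (isClosed_tsupport _) hs,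
    hs.trans hLU⟩, fun x hx => h1.filter_mono (nhds_le_nhdsSet hx), h3⟩

/-- A function with nonnegative integral against every nonnegative test function is nonnegative
almost everywhere. -/
theorem ae_nonneg_of_forall_isTestFunction (hΩ : IsOpen Ω) {f : EuclideanSpace ℝ (Fin N) → ℝ}
    (hf : Integrable f (volume.restrict Ω))
    (h : ∀ φ, IsTestFunction Ω φ → (∀ x, 0 ≤ φ x) → 0 ≤ ∫ x in Ω, φ x * f x) :
    ∀ᵐ x ∂(volume.restrict Ω), 0 ≤ f x := by
  have hcomp : ∀ K ⊆ Ω, IsCompact K → 0 ≤ ∫ x in K, f x := by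
    intro K hKΩ hK
    have hU : ∀ n : ℕ, IsOpen (Ω ∩ Metric.thickening (1 / ((n : ℝ) + 1)) K) :=
      fun n => hΩ.inter Metric.isOpen_thickening
    choose χ hχ h1 h2 using fun n : ℕ => exists_isTestFunction_eq_one hK (hU n)
      (Set.subset_inter hKΩ (Metric.self_subset_thickening (by positivity) K))
    have hχΩ : ∀ n, IsTestFunction Ω (χ n) :=
      fun n => ⟨(hχ n).1, (hχ n).2.1, (hχ n).2.2.trans Set.inter_subset_left⟩
    have hlim : Tendsto (fun n => ∫ x in Ω, χ n x * f x) atTop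
        (𝓝 (∫ x in Ω, K.indicator f x)) := by
      refine tendsto_integral_of_dominated_convergence (fun x => ‖f x‖)
        (fun n => (hχ n).1.continuous.aestronglyMeasurable.mul hf.1) hf.norm
        (fun n => ae_of_all _ fun x => ?_) (ae_of_all _ fun x => ?_)
      · rw [norm_mul, Real.norm_of_nonneg (h2 n x).1]
        exact mul_le_of_le_one_left (norm_nonneg _) (h2 n x).2
      · by_cases hx : x ∈ K
        · rw [Set.indicator_of_mem hx]
          refine tendsto_const_nhds.congr fun n => ?_
          rw [(h1 n x hx).self_of_nhds, one_mul]
        · rw [Set.indicator_of_notMem hx]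
          refine tendsto_const_nhds.congr' ?_
          obtain ⟨ε, hε, hxε⟩ : ∃ ε, 0 < ε ∧ x ∉ Metric.thickening ε K := by
            rw [← hK.isClosed.closure_eq, Metric.closure_eq_iInter_thickening K] at hx
            simpa using hx
          filter_upwards [tendsto_one_div_add_atTop_nhds_zero_nat.eventually_lt_const hε] with n hn
          have hx0 : χ n x = 0 := image_eq_zero_of_notMem_tsupport fun hx' =>
            hxε (Metric.thickening_mono hn.le K ((hχ n).2.2 hx').2)
          rw [hx0, zero_mul]
    rw [integral_indicator hK.measurableSet, Measure.restrict_restrict hK.measurableSet,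
      Set.inter_eq_self_of_subset_left hKΩ] at hlim
    exact ge_of_tendsto' hlim fun n => h _ (hχΩ n) fun x => (h2 n x).1
  -- A compact subset of `{f < 0}` of positive measure would contradict `hcomp`.
  obtain ⟨g, hgm, hfg⟩ := hf.1
  have hg : Integrable g (volume.restrict Ω) := hf.congr hfg
  by_contra hneg
  have hS : MeasurableSet ({x | g x < 0} ∩ Ω) :=
    (hgm.measurable measurableSet_Iio).inter hΩ.measurableSet
  have hpos : 0 < volume ({x | g x < 0} ∩ Ω) := by
    rw [pos_iff_ne_zero]
    intro h0
    apply hneg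
    have h0' : ∀ᵐ x ∂(volume.restrict Ω), ¬ g x < 0 := by
      rw [ae_iff]
      simp only [not_not]
      exact (Measure.restrict_apply (hgm.measurable measurableSet_Iio)).trans h0
    filter_upwards [h0', hfg] with x h1 h2
    rw [h2]
    exact not_lt.1 h1
  obtain ⟨K, hKS, hK, hKpos⟩ := hS.exists_lt_isCompact hpos
  have hKΩ : K ⊆ Ω := hKS.trans Set.inter_subset_right
  have hfgK : f =ᵐ[volume.restrict K] g := ae_restrict_of_ae_restrict_of_subset hKΩ hfg
  have h1 := hcomp K hKΩ hK
  rw [integral_congr_ae hfgK] at h1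
  have hgK : Integrable (fun x => - g x) (volume.restrict K) :=
    (hg.mono_measure (Measure.restrict_mono_set _ hKΩ)).neg
  have h2 : 0 < ∫ x in K, - g x := by
    rw [setIntegral_pos_iff_support_of_nonneg_ae
      (ae_restrict_of_forall_mem hK.measurableSet fun x hx => by
        have : g x < 0 := (hKS hx).1
        simp only [Pi.zero_apply]
        linarith) hgK]
    refine hKpos.trans_le (measure_mono fun x hx => ⟨?_, hx⟩)
    have : g x < 0 := (hKS hx).1
    simp only [Function.mem_support]
    linarith
  rw [integral_neg] at h2
  linarith

end Cutoff

section CorrectorLimits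
variable {N : ℕ} {Ω : Set (EuclideanSpace ℝ (Fin N))} {γ₀ γ₁ : ℝ}
  {ω : ℕ → Set (EuclideanSpace ℝ (Fin N))}
  {B : EuclideanSpace ℝ (Fin N) → Matrix (Fin N) (Fin N) ℝ} {ξ : EuclideanSpace ℝ (Fin N)}
  {z : ℕ → EuclideanSpace ℝ (Fin N) → ℝ}
  {X : ℕ → EuclideanSpace ℝ (Fin N) → EuclideanSpace ℝ (Fin N)}

theorem IsCorrectorAlong.weakTendstoL2_const [NeZero N] (hΩb : Bornology.IsBounded Ω)
    (h₀ : 0 < γ₀) (h₁ : 0 < γ₁) (hωm : ∀ n, MeasurableSet (ω n))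
    (hB : IsConductivity (min γ₀ γ₁) (max γ₀ γ₁) Ω B)
    (hH : HConverges Ω (fun n => twoPhase γ₀ γ₁ (ω n)) B)
    (h : ∀ n, IsCorrectorAlong Ω (twoPhase γ₀ γ₁ (ω n)) B ξ (z n) (X n)) :
    WeakTendstoL2 Ω X (fun _ => ξ) := by
  intro ψ hψ
  have h1 := (IsCorrectorAlong.weakTendsto hΩb h₀ h₁ hωm hB hH h ψ hψ).add_const
    (∫ x in Ω, inner ℝ ξ (ψ x))
  simp only [inner_zero_left, integral_zero, zero_add] at h1
  refine h1.congr fun n => ?_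
  rw [← integral_add (integrable_inner_of_memLp (h n).1.2.1 hψ)
    (integrable_inner_of_memLp (memLp_const_of_isBounded hΩb ξ) hψ)]
  simp only [← inner_add_left, sub_add_cancel]

theorem IsCorrectorAlong.exists_eLpNorm_flux_le [NeZero N] (hΩb : Bornology.IsBounded Ω)
    (h₀ : 0 < γ₀) (h₁ : 0 < γ₁) (hωm : ∀ n, MeasurableSet (ω n))
    (hB : IsConductivity (min γ₀ γ₁) (max γ₀ γ₁) Ω B)
    (hH : HConverges Ω (fun n => twoPhase γ₀ γ₁ (ω n)) B)
    (h : ∀ n, IsCorrectorAlong Ω (twoPhase γ₀ γ₁ (ω n)) B ξ (z n) (X n)) :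
    ∃ C : ℝ, ∀ n, (eLpNorm (flux (twoPhase γ₀ γ₁ (ω n)) (X n)) 2 (volume.restrict Ω)).toReal
      ≤ C := by
  obtain ⟨C, -, hC⟩ := exists_eLpNorm_le_of_weak (fun n => (h n).memLp hΩb)
    (IsCorrectorAlong.weakTendstoL2_const hΩb h₀ h₁ hωm hB hH h)
  refine ⟨max γ₀ γ₁ * C, fun n => ?_⟩
  refine (eLpNorm_flux_twoPhase_le h₀ h₁ (ω n) ((h n).memLp hΩb)).trans ?_
  exact mul_le_mul_of_nonneg_left (hC n) (h₀.le.trans (le_max_left _ _))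

/-- The div-curl lemma, with the correctors as the gradient fields. -/
theorem IsCorrectorAlong.tendsto_integral_div_curl [NeZero N] (hΩ : IsOpen Ω)
    (hΩb : Bornology.IsBounded Ω)
    (h₀ : 0 < γ₀) (h₁ : 0 < γ₁) (hωm : ∀ n, MeasurableSet (ω n))
    (hB : IsConductivity (min γ₀ γ₁) (max γ₀ γ₁) Ω B)
    (hH : HConverges Ω (fun n => twoPhase γ₀ γ₁ (ω n)) B)
    (h : ∀ n, IsCorrectorAlong Ω (twoPhase γ₀ γ₁ (ω n)) B ξ (z n) (X n))
    {D : ℕ → EuclideanSpace ℝ (Fin N) → EuclideanSpace ℝ (Fin N)}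
    {F : EuclideanSpace ℝ (Fin N) → EuclideanSpace ℝ (Fin N)} {C : ℝ}
    (hD : ∀ n, MemLp (D n) 2 (volume.restrict Ω))
    (hDC : ∀ n, (eLpNorm (D n) 2 (volume.restrict Ω)).toReal ≤ C)
    (hF : MemLp F 2 (volume.restrict Ω))
    (hdiv : ∀ n, ∀ φ : EuclideanSpace ℝ (Fin N) → ℝ, IsTestFunction Ω φ →
      ∫ x in Ω, inner ℝ (D n x) (gradient φ x) = ∫ x in Ω, inner ℝ (F x) (gradient φ x))
    {φ : EuclideanSpace ℝ (Fin N) → ℝ} (hφ : IsTestFunction Ω φ) :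
    Tendsto (fun n => (∫ x in Ω, φ x * inner ℝ (D n x) (X n x)) +
        ∫ x in Ω, inner ℝ (D n x) ((inner ℝ ξ x : ℝ) • gradient φ x)) atTop
      (𝓝 ((∫ x in Ω, φ x * inner ℝ (F x) ξ) +
        ∫ x in Ω, inner ℝ (F x) ((inner ℝ ξ x : ℝ) • gradient φ x))) := by
  have hl := memLp_inner_of_isBounded hΩ hΩb ξ
  refine _root_.tendsto_integral_div_curl hD hDC hF hdiv (fun n => hl.add (h n).1.1) hl
    (fun n => (h n).memLp hΩb) (fun n φ hφ => (h n).test_mul hφ) ?_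
    (IsCorrectorAlong.weakTendstoL2_const hΩb h₀ h₁ hωm hB hH h) hφ
  simpa using IsCorrectorAlong.tendsto_eLpNorm_zero hΩb h₀ h₁ hωm hB hH h

/-- The fluxes of the correctors converge to `B ξ` in the sense of distributions. -/
theorem IsCorrectorAlong.tendsto_integral_flux [NeZero N] (hΩ : IsOpen Ω)
    (hΩb : Bornology.IsBounded Ω)
    (h₀ : 0 < γ₀) (h₁ : 0 < γ₁) (hωm : ∀ n, MeasurableSet (ω n))
    (hB : IsConductivity (min γ₀ γ₁) (max γ₀ γ₁) Ω B)
    (hH : HConverges Ω (fun n => twoPhase γ₀ γ₁ (ω n)) B)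
    (h : ∀ n, IsCorrectorAlong Ω (twoPhase γ₀ γ₁ (ω n)) B ξ (z n) (X n))
    {v : EuclideanSpace ℝ (Fin N) → ℝ} (hv : IsTestFunction Ω v) (η : EuclideanSpace ℝ (Fin N)) :
    Tendsto (fun n => ∫ x in Ω, v x * inner ℝ (flux (twoPhase γ₀ γ₁ (ω n)) (X n) x) η) atTop
      (𝓝 (∫ x in Ω, v x * inner ℝ (flux B (fun _ => ξ) x) η)) := by
  have hmin : 0 < min γ₀ γ₁ := lt_min h₀ h₁
  -- `φ` is a cutoff of the linear function `⟨η, ·⟩`, so that `v ∇φ = v η`.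
  obtain ⟨χ, hχ, hχ1, -⟩ := exists_isTestFunction_eq_one hv.2.1 hΩ hv.2.2
  obtain ⟨φ, hφ, hφv⟩ : ∃ φ : EuclideanSpace ℝ (Fin N) → ℝ, IsTestFunction Ω φ ∧
      ∀ x, v x • gradient φ x = v x • η := by
    refine ⟨_, hχ.mul_contDiff (contDiff_inner_const η), fun x => ?_⟩
    by_cases hx : x ∈ tsupport v
    · have : (fun y => χ y * (inner ℝ η y : ℝ)) =ᶠ[𝓝 x] fun y => (inner ℝ η y : ℝ) := by
        filter_upwards [hχ1 x hx] with y hy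
        rw [hy, one_mul]
      rw [this.gradient_eq, gradient_inner_const]
    · rw [image_eq_zero_of_notMem_tsupport hx, zero_smul, zero_smul]
  have hBv : MemLp (flux B (gradient v)) 2 (volume.restrict Ω) :=
    hB.memLp_flux hmin.le (hv.memLp_gradient 2 Ω)
  have hξ := memLp_const_of_isBounded hΩb ξ
  have hBξ := hB.memLp_flux hmin.le hξ
  choose u G hu hsol using fun n => exists_dirichlet_solution_twoPhase hΩb h₀ h₁ (hωm n) hBv
  obtain ⟨huw, hGw, hDw⟩ := hH _ hBv u G v (gradient v) (fun n => ⟨hu n, hsol n⟩) hv.memH10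
    (fun _ _ => rfl)
  have hDm : ∀ n, MemLp (flux (twoPhase γ₀ γ₁ (ω n)) (G n)) 2 (volume.restrict Ω) :=
    fun n => memLp_flux_twoPhase h₀ h₁ (hωm n) (hu n).2.1
  obtain ⟨C, -, hC⟩ := exists_eLpNorm_le_of_weak hDm hDw
  -- The fluxes of `u n` against the correctors as gradients.
  have e1 := IsCorrectorAlong.tendsto_integral_div_curl hΩ hΩb h₀ h₁ hωm hB hH h hDm hC hBv hsol hφ
  obtain ⟨K', hK0', hK'⟩ := hφ.exists_bound_gradient
  have hgm := (contDiff_gradient hφ.1).continuous.aestronglyMeasurable (μ := volume.restrict Ω)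
  have e2 := e1.sub (hDw _ (memLp_smul_of_norm_le (memLp_inner_of_isBounded hΩ hΩb ξ) hgm hK'))
  simp only [add_sub_cancel_right] at e2
  obtain ⟨C', hC'⟩ := IsCorrectorAlong.exists_eLpNorm_flux_le hΩb h₀ h₁ hωm hB hH h
  -- The fluxes of the correctors against `∇(u n)`.
  have e3 := _root_.tendsto_integral_div_curl
    (fun n => memLp_flux_twoPhase h₀ h₁ (hωm n) ((h n).memLp hΩb)) hC' hBξ
    (fun n => (h n).2) (fun n => (hu n).1) (hv.memLp 2 Ω) (fun n => (hu n).2.1)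
    (fun n φ hφ => (hu n).test_mul hφ)
    (tendsto_eLpNorm_sub_of_weak hΩb hu hv.memH10 huw hGw) hGw hφ
  have e4 := e3.sub e2
  have hsymm : ∫ x in Ω, φ x * inner ℝ (flux B (fun _ => ξ) x) (gradient v x) =
      ∫ x in Ω, φ x * inner ℝ (flux B (gradient v) x) ξ := by
    refine integral_congr_ae ?_
    filter_upwards [hB.ae_inner_flux_comm (fun _ => ξ) (gradient v)] with x hx
    rw [hx]
  have hsymm' : ∀ n, ∫ x in Ω, φ x * inner ℝ (flux (twoPhase γ₀ γ₁ (ω n)) (G n) x) (X n x) =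
      ∫ x in Ω, φ x * inner ℝ (flux (twoPhase γ₀ γ₁ (ω n)) (X n) x) (G n x) := fun n => by
    congr 1
    ext x
    rw [flux_twoPhase, flux_twoPhase, real_inner_smul_left, real_inner_smul_left, real_inner_comm]
  simp only [hsymm, hsymm', add_sub_cancel_left, hφv, real_inner_smul_right] at e4
  exact e4

/-- Convergence of the energy density of the correctors in the sense of distributions. -/
theorem IsCorrectorAlong.tendsto_integral_energy [NeZero N] (hΩ : IsOpen Ω)
    (hΩb : Bornology.IsBounded Ω)
    (h₀ : 0 < γ₀) (h₁ : 0 < γ₁) (hωm : ∀ n, MeasurableSet (ω n))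
    (hB : IsConductivity (min γ₀ γ₁) (max γ₀ γ₁) Ω B)
    (hH : HConverges Ω (fun n => twoPhase γ₀ γ₁ (ω n)) B)
    (h : ∀ n, IsCorrectorAlong Ω (twoPhase γ₀ γ₁ (ω n)) B ξ (z n) (X n))
    {φ : EuclideanSpace ℝ (Fin N) → ℝ} (hφ : IsTestFunction Ω φ) :
    Tendsto (fun n => ∫ x in Ω, φ x * inner ℝ (flux (twoPhase γ₀ γ₁ (ω n)) (X n) x) (X n x)) atTop
      (𝓝 (∫ x in Ω, φ x * inner ℝ (flux B (fun _ => ξ) x) ξ)) := by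
  have hmin : 0 < min γ₀ γ₁ := lt_min h₀ h₁
  have hBξ := hB.memLp_flux hmin.le (memLp_const_of_isBounded hΩb ξ)
  have hDm := fun n => memLp_flux_twoPhase h₀ h₁ (hωm n) ((h n).memLp hΩb)
  obtain ⟨C, hC⟩ := IsCorrectorAlong.exists_eLpNorm_flux_le hΩb h₀ h₁ hωm hB hH h
  have e1 := IsCorrectorAlong.tendsto_integral_div_curl hΩ hΩb h₀ h₁ hωm hB hH h hDm hC hBξ
    (fun n => (h n).2) hφ
  -- The coordinates of `⟨ξ, x⟩ ∇φ` are test functions.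
  have htest : ∀ j, IsTestFunction Ω (fun x => (inner ℝ ξ x : ℝ) * gradient φ x j) :=
    fun j => (hφ.gradient_coord j).contDiff_mul (contDiff_inner_const ξ)
  have hsum : ∀ {K : EuclideanSpace ℝ (Fin N) → EuclideanSpace ℝ (Fin N)},
      MemLp K 2 (volume.restrict Ω) →
      ∫ x in Ω, inner ℝ (K x) ((inner ℝ ξ x : ℝ) • gradient φ x) =
      ∑ j, ∫ x in Ω, (inner ℝ ξ x * gradient φ x j) *
        inner ℝ (K x) (EuclideanSpace.single j 1) := fun {K} hK => by
    rw [← integral_finsetSum]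
    · congr 1
      ext x
      rw [PiLp.inner_apply]
      refine Finset.sum_congr rfl fun j _ => ?_
      simp [EuclideanSpace.inner_single_right]
    · intro j _
      have := integrable_inner_of_memLp hK (memLp_smul_of_norm_le
        (g := fun _ => EuclideanSpace.single j (1 : ℝ)) ((htest j).memLp 2 Ω)
        aestronglyMeasurable_const (fun _ => le_rfl))
      simpa only [real_inner_smul_right] using this
  have e2 := tendsto_finsetSum Finset.univ fun j _ =>
    IsCorrectorAlong.tendsto_integral_flux hΩ hΩb h₀ h₁ hωm hB hH h (htest j)
      (EuclideanSpace.single j 1)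
  have e3 := e1.sub e2
  simp only [hsum hBξ, hsum (hDm _), add_sub_cancel_right] at e3
  exact e3

end CorrectorLimits

/-! ### Mean bounds and the limit measure -/

section Bounds
variable {N : ℕ} {Ω : Set (EuclideanSpace ℝ (Fin N))} {γ₀ γ₁ : ℝ}
  {ω : ℕ → Set (EuclideanSpace ℝ (Fin N))} {θ : EuclideanSpace ℝ (Fin N) → ℝ}
  {B : EuclideanSpace ℝ (Fin N) → Matrix (Fin N) (Fin N) ℝ} {ξ : EuclideanSpace ℝ (Fin N)}
  {z : ℕ → EuclideanSpace ℝ (Fin N) → ℝ}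
  {X : ℕ → EuclideanSpace ℝ (Fin N) → EuclideanSpace ℝ (Fin N)}

theorem IsVolumeFraction.integrable (hΩb : Bornology.IsBounded Ω)
    (hθ : IsVolumeFraction Ω ω θ) : Integrable θ (volume.restrict Ω) := by
  have := isFiniteMeasure_restrict_of_isBounded hΩb
  refine Integrable.of_bound hθ.1 1 ?_
  filter_upwards [hθ.2.1] with x hx
  rw [Real.norm_of_nonneg hx.1]
  exact hx.2

theorem IsVolumeFraction.integrable_mix (hΩb : Bornology.IsBounded Ω)
    (hθ : IsVolumeFraction Ω ω θ) (c₀ c₁ : ℝ) :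
    Integrable (fun x => c₁ * θ x + c₀ * (1 - θ x)) (volume.restrict Ω) := by
  have := isFiniteMeasure_restrict_of_isBounded hΩb
  have h := hθ.integrable hΩb
  exact (h.const_mul c₁).add (((integrable_const 1).sub h).const_mul c₀)

theorem integrable_indicator_mul {s : Set (EuclideanSpace ℝ (Fin N))} (hs : MeasurableSet s)
    {f : EuclideanSpace ℝ (Fin N) → ℝ} {ν : Measure (EuclideanSpace ℝ (Fin N))}
    (hf : Integrable f ν) : Integrable (fun x => s.indicator 1 x * f x) ν := by
  refine (hf.indicator hs).congr (ae_of_all _ fun x => ?_)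
  by_cases hx : x ∈ s <;> simp [hx]

theorem IsVolumeFraction.tendsto_integral_phase (hωm : ∀ n, MeasurableSet (ω n))
    (hθ : IsVolumeFraction Ω ω θ) (c₀ c₁ : ℝ)
    {φ : EuclideanSpace ℝ (Fin N) → ℝ} (hφ : IsTestFunction Ω φ) :
    Tendsto (fun n => ∫ x in Ω, φ x * phase c₀ c₁ (ω n) x) atTop
      (𝓝 (∫ x in Ω, φ x * (c₁ * θ x + c₀ * (1 - θ x)))) := by
  have hi : Integrable φ (volume.restrict Ω) := memLp_one_iff_integrable.1 (hφ.memLp 1 Ω)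
  have h := ((hθ.2.2 φ hi).const_mul (c₁ - c₀)).add_const (c₀ * ∫ x in Ω, φ x)
  have hiθ : Integrable (fun x => θ x * φ x) (volume.restrict Ω) := by
    refine hi.bdd_mul (c := 1) hθ.1 ?_
    filter_upwards [hθ.2.1] with x hx
    rw [Real.norm_of_nonneg hx.1]
    exact hx.2
  have e : ∀ f : EuclideanSpace ℝ (Fin N) → ℝ,
      Integrable (fun x => f x * φ x) (volume.restrict Ω) →
      (c₁ - c₀) * (∫ x in Ω, f x * φ x) + c₀ * ∫ x in Ω, φ x =
        ∫ x in Ω, φ x * (c₁ * f x + c₀ * (1 - f x)) := fun f hf => by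
    rw [← integral_const_mul, ← integral_const_mul,
      ← integral_add (hf.const_mul _) (hi.const_mul _)]
    congr 1
    ext x
    ring
  rw [e θ hiθ] at h
  refine h.congr fun n => ?_
  rw [e _ (integrable_indicator_mul (hωm n) hi)]
  rfl

theorem IsTestFunction.integrable_mul {φ f : EuclideanSpace ℝ (Fin N) → ℝ}
    (hφ : IsTestFunction Ω φ) (hf : Integrable f (volume.restrict Ω)) :
    Integrable (fun x => φ x * f x) (volume.restrict Ω) := by
  obtain ⟨K, -, hK⟩ := hφ.exists_bound
  exact hf.bdd_mul hφ.1.continuous.aestronglyMeasurable (ae_of_all _ hK)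

theorem IsTestFunction.integral_mul_combination {φ f g h : EuclideanSpace ℝ (Fin N) → ℝ}
    (hφ : IsTestFunction Ω φ) (hf : Integrable f (volume.restrict Ω))
    (hg : Integrable g (volume.restrict Ω)) (hh : Integrable h (volume.restrict Ω)) (c d : ℝ) :
    ∫ x in Ω, φ x * (f x - c * g x + d * h x) =
      (∫ x in Ω, φ x * f x) - c * (∫ x in Ω, φ x * g x) + d * ∫ x in Ω, φ x * h x := by
  have hfg : Integrable (fun x => φ x * f x - c * (φ x * g x)) (volume.restrict Ω) :=
    (hφ.integrable_mul hf).sub ((hφ.integrable_mul hg).const_mul _)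
  rw [← integral_const_mul, ← integral_const_mul,
    ← integral_sub (hφ.integrable_mul hf) ((hφ.integrable_mul hg).const_mul _),
    ← integral_add hfg ((hφ.integrable_mul hh).const_mul _)]
  congr 1
  ext x
  ring

theorem IsConductivity.integrable_inner_flux (hΩb : Bornology.IsBounded Ω)
    (h₀ : 0 < γ₀) (h₁ : 0 < γ₁)
    (hB : IsConductivity (min γ₀ γ₁) (max γ₀ γ₁) Ω B) (ξ η : EuclideanSpace ℝ (Fin N)) :
    Integrable (fun x => (inner ℝ (flux B (fun _ => ξ) x) η : ℝ)) (volume.restrict Ω) :=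
  integrable_inner_of_memLp (hB.memLp_flux (lt_min h₀ h₁).le (memLp_const_of_isBounded hΩb ξ))
    (memLp_const_of_isBounded hΩb η)

theorem integrable_phase (hΩb : Bornology.IsBounded Ω) {c₀ c₁ : ℝ} (h₀ : 0 < c₀) (h₁ : 0 < c₁)
    {s : Set (EuclideanSpace ℝ (Fin N))} (hs : MeasurableSet s) :
    Integrable (phase c₀ c₁ s) (volume.restrict Ω) := by
  have := isFiniteMeasure_restrict_of_isBounded hΩb
  exact Integrable.of_bound (measurable_phase c₀ c₁ hs).aestronglyMeasurable (max c₀ c₁)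
    (ae_of_all _ (norm_phase_le h₀ h₁ s))

theorem phase_mul_phase_inv (h₀ : 0 < γ₀) (h₁ : 0 < γ₁) (s : Set (EuclideanSpace ℝ (Fin N)))
    (x : EuclideanSpace ℝ (Fin N)) : phase γ₀ γ₁ s x * phase γ₀⁻¹ γ₁⁻¹ s x = 1 := by
  by_cases hx : x ∈ s
  · rw [phase_of_mem hx, phase_of_mem hx, mul_inv_cancel₀ h₁.ne']
  · rw [phase_of_notMem hx, phase_of_notMem hx, mul_inv_cancel₀ h₀.ne']

/-- The arithmetic mean bound, from `0 ≤ γ_n |X n - ξ|²`. -/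
theorem IsCorrectorAlong.ae_le_arithmetic [NeZero N] (hΩ : IsOpen Ω)
    (hΩb : Bornology.IsBounded Ω)
    (h₀ : 0 < γ₀) (h₁ : 0 < γ₁) (hωm : ∀ n, MeasurableSet (ω n)) (hθ : IsVolumeFraction Ω ω θ)
    (hB : IsConductivity (min γ₀ γ₁) (max γ₀ γ₁) Ω B)
    (hH : HConverges Ω (fun n => twoPhase γ₀ γ₁ (ω n)) B)
    (h : ∀ n, IsCorrectorAlong Ω (twoPhase γ₀ γ₁ (ω n)) B ξ (z n) (X n)) :
    ∀ᵐ x ∂(volume.restrict Ω), inner ℝ (flux B (fun _ => ξ) x) ξ ≤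
      (γ₁ * θ x + γ₀ * (1 - θ x)) * ‖ξ‖ ^ 2 := by
  have hBi := hB.integrable_inner_flux hΩb h₀ h₁ ξ ξ
  have hmix := hθ.integrable_mix hΩb γ₀ γ₁
  have hDm := fun n => memLp_flux_twoPhase h₀ h₁ (hωm n) ((h n).memLp hΩb)
  have hnn := ae_nonneg_of_forall_isTestFunction hΩ (f := fun x =>
    inner ℝ (flux B (fun _ => ξ) x) ξ - 2 * inner ℝ (flux B (fun _ => ξ) x) ξ +
      ‖ξ‖ ^ 2 * (γ₁ * θ x + γ₀ * (1 - θ x)))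
    ((hBi.sub (hBi.const_mul 2)).add (hmix.const_mul _)) (fun φ hφ hφ0 => by
      rw [hφ.integral_mul_combination hBi hBi hmix]
      have e := ((IsCorrectorAlong.tendsto_integral_energy hΩ hΩb h₀ h₁ hωm hB hH h hφ).sub
        ((IsCorrectorAlong.tendsto_integral_flux hΩ hΩb h₀ h₁ hωm hB hH h hφ ξ).const_mul 2)).add
        ((hθ.tendsto_integral_phase hωm γ₀ γ₁ hφ).const_mul (‖ξ‖ ^ 2))
      refine ge_of_tendsto' e fun n => ?_
      rw [← hφ.integral_mul_combination
        (integrable_inner_of_memLp (hDm n) ((h n).memLp hΩb))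
        (integrable_inner_of_memLp (hDm n) (memLp_const_of_isBounded hΩb ξ))
        (integrable_phase hΩb h₀ h₁ (hωm n))]
      refine integral_nonneg fun x => mul_nonneg (hφ0 x) ?_
      have hp : 0 ≤ phase γ₀ γ₁ (ω n) x := (lt_min h₀ h₁).le.trans (min_le_phase _ _ _ _)
      have e2 := mul_nonneg hp (sq_nonneg ‖X n x - ξ‖)
      rw [norm_sub_sq_real] at e2
      rw [flux_twoPhase, real_inner_smul_left, real_inner_smul_left, real_inner_self_eq_norm_sq]
      linarith)
  filter_upwards [hnn] with x hx
  linarith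

/-- The quadratic inequality behind the harmonic mean bound, from
`0 ≤ γ_n⁻¹ |γ_n X n - t ξ|²`. -/
theorem IsCorrectorAlong.ae_nonneg_quadratic [NeZero N] (hΩ : IsOpen Ω)
    (hΩb : Bornology.IsBounded Ω)
    (h₀ : 0 < γ₀) (h₁ : 0 < γ₁) (hωm : ∀ n, MeasurableSet (ω n)) (hθ : IsVolumeFraction Ω ω θ)
    (hB : IsConductivity (min γ₀ γ₁) (max γ₀ γ₁) Ω B)
    (hH : HConverges Ω (fun n => twoPhase γ₀ γ₁ (ω n)) B)
    (h : ∀ n, IsCorrectorAlong Ω (twoPhase γ₀ γ₁ (ω n)) B ξ (z n) (X n)) (t : ℝ) :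
    ∀ᵐ x ∂(volume.restrict Ω), 0 ≤ inner ℝ (flux B (fun _ => ξ) x) ξ - 2 * t * ‖ξ‖ ^ 2 +
      t ^ 2 * ‖ξ‖ ^ 2 * (γ₁⁻¹ * θ x + γ₀⁻¹ * (1 - θ x)) := by
  have := isFiniteMeasure_restrict_of_isBounded hΩb
  have hBi := hB.integrable_inner_flux hΩb h₀ h₁ ξ ξ
  have hmix := hθ.integrable_mix hΩb γ₀⁻¹ γ₁⁻¹
  have hξ := memLp_const_of_isBounded hΩb ξ
  have hDm := fun n => memLp_flux_twoPhase h₀ h₁ (hωm n) ((h n).memLp hΩb)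
  refine ae_nonneg_of_forall_isTestFunction hΩ
    ((hBi.sub (integrable_const _)).add (hmix.const_mul _)) (fun φ hφ hφ0 => ?_)
  rw [hφ.integral_mul_combination hBi (integrable_const (‖ξ‖ ^ 2)) hmix]
  have hX := IsCorrectorAlong.weakTendstoL2_const hΩb h₀ h₁ hωm hB hH h (fun x => φ x • ξ)
    (memLp_smul_of_norm_le (hφ.memLp 2 Ω) aestronglyMeasurable_const (fun _ => le_rfl))
  simp only [real_inner_smul_right, real_inner_self_eq_norm_sq] at hX
  have e := ((IsCorrectorAlong.tendsto_integral_energy hΩ hΩb h₀ h₁ hωm hB hH h hφ).sub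
    (hX.const_mul (2 * t))).add
    ((hθ.tendsto_integral_phase hωm γ₀⁻¹ γ₁⁻¹ hφ).const_mul (t ^ 2 * ‖ξ‖ ^ 2))
  refine ge_of_tendsto' e fun n => ?_
  rw [← hφ.integral_mul_combination
    (integrable_inner_of_memLp (hDm n) ((h n).memLp hΩb))
    (integrable_inner_of_memLp ((h n).memLp hΩb) hξ)
    (integrable_phase hΩb (inv_pos.2 h₀) (inv_pos.2 h₁) (hωm n))]
  refine integral_nonneg fun x => mul_nonneg (hφ0 x) ?_
  have hp : 0 ≤ phase γ₀⁻¹ γ₁⁻¹ (ω n) x :=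
    (lt_min (inv_pos.2 h₀) (inv_pos.2 h₁)).le.trans (min_le_phase _ _ _ _)
  have e2 := mul_nonneg hp (sq_nonneg ‖phase γ₀ γ₁ (ω n) x • X n x - t • ξ‖)
  have e3 := phase_mul_phase_inv h₀ h₁ (ω n) x
  rw [norm_sub_sq_real, norm_smul, norm_smul, mul_pow, mul_pow, Real.norm_eq_abs, Real.norm_eq_abs,
    sq_abs, sq_abs, real_inner_smul_left, real_inner_smul_right] at e2
  rw [flux_twoPhase, real_inner_smul_left, real_inner_self_eq_norm_sq]
  refine e2.trans (le_of_eq ?_)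
  linear_combination (phase γ₀ γ₁ (ω n) x * ‖X n x‖ ^ 2 - 2 * t * inner ℝ (X n x) ξ) * e3

/-- Minimization of the quadratic polynomial at `t = 1 / m`. -/
theorem le_mul_of_quadratic_nonneg {b m r : ℝ} (hm : 0 < m)
    (h : ∀ t : ℚ, 0 ≤ b - 2 * t * r + (t : ℝ) ^ 2 * r * m) : r ≤ m * b := by
  have hc : IsClosed {t : ℝ | 0 ≤ b - 2 * t * r + t ^ 2 * r * m} :=
    isClosed_le continuous_const (by fun_prop)
  have h1 : (1 / m) ∈ {t : ℝ | 0 ≤ b - 2 * t * r + t ^ 2 * r * m} :=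
    (Rat.denseRange_cast (𝕜 := ℝ)).induction_on (1 / m) hc h
  change 0 ≤ b - 2 * (1 / m) * r + (1 / m) ^ 2 * r * m at h1
  have h2 : b - 2 * (1 / m) * r + (1 / m) ^ 2 * r * m = b - r / m := by
    field_simp
    ring
  rw [h2, sub_nonneg, div_le_iff₀ hm] at h1
  linarith

end Bounds

section Polarization
variable {N : ℕ} {Ω : Set (EuclideanSpace ℝ (Fin N))} {γ₀ γ₁ : ℝ}
  {ω : ℕ → Set (EuclideanSpace ℝ (Fin N))} {θ : EuclideanSpace ℝ (Fin N) → ℝ}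
  {B : EuclideanSpace ℝ (Fin N) → Matrix (Fin N) (Fin N) ℝ}
  {μ : Measure (EuclideanSpace ℝ (Fin N))}

theorem IsVolumeFraction.aemeasurable_density (hθ : IsVolumeFraction Ω ω θ) (δ : ℝ) :
    AEMeasurable (fun x => ENNReal.ofReal (δ⁻¹ * θ x)) (volume.restrict Ω) :=
  (hθ.1.aemeasurable.const_mul _).ennreal_ofReal

theorem IsVolumeFraction.integral_withDensity (hθ : IsVolumeFraction Ω ω θ) {δ : ℝ} (hδ : 0 < δ)
    (g : EuclideanSpace ℝ (Fin N) → ℝ) :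
    ∫ x, g x ∂((volume.restrict Ω).withDensity fun x => ENNReal.ofReal (δ⁻¹ * θ x)) =
      δ⁻¹ * ∫ x in Ω, θ x * g x := by
  rw [integral_withDensity_eq_integral_toReal_smul₀ (hθ.aemeasurable_density δ)
    (ae_of_all _ fun _ => ENNReal.ofReal_lt_top), ← integral_const_mul]
  refine integral_congr_ae ?_
  filter_upwards [hθ.2.1] with x hx
  rw [ENNReal.toReal_ofReal (mul_nonneg (inv_nonneg.2 hδ.le) hx.1), smul_eq_mul, mul_assoc]

/-- The limit measure is `θ / δ` times the Lebesgue measure on `Ω`. -/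
theorem measure_eq_withDensity (hΩb : Bornology.IsBounded Ω)
    (hωm : ∀ n, MeasurableSet (ω n)) (hωΩ : ∀ n, ω n ⊆ Ω) {δ : ℝ} (hδ : 0 < δ)
    (hωδ : Tendsto (fun n => volume.real (ω n)) atTop (𝓝 δ)) (hθ : IsVolumeFraction Ω ω θ)
    [IsFiniteMeasure μ] {σ : ℕ → ℕ} (hσ : StrictMono σ)
    (h : WeakStarTendsto (fun k => ω (σ k)) (fun _ _ => 1) (fun _ => 1) μ) :
    μ = (volume.restrict Ω).withDensity fun x => ENNReal.ofReal (δ⁻¹ * θ x) := by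
  have hfin := isFiniteMeasure_restrict_of_isBounded hΩb
  have : IsFiniteMeasure ((volume.restrict Ω).withDensity fun x => ENNReal.ofReal (δ⁻¹ * θ x)) :=
    isFiniteMeasure_withDensity_ofReal ((hθ.integrable hΩb).const_mul _).2
  refine ext_of_forall_integral_eq_of_IsFiniteMeasure fun φ => ?_
  rw [hθ.integral_withDensity hδ]
  have hφ : Integrable φ (volume.restrict Ω) := φ.integrable _
  have e1 := h φ φ.continuous
  simp only [one_mul] at e1
  have e2 := ((hωδ.inv₀ hδ.ne').mul (hθ.2.2 φ hφ)).comp hσ.tendsto_atTop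
  refine tendsto_nhds_unique e1 (e2.congr fun k => ?_)
  simp only [Function.comp_apply]
  congr 1
  have e3 : ∀ x, (ω (σ k)).indicator 1 x * φ x = (ω (σ k)).indicator φ x := fun x => by
    by_cases hx : x ∈ ω (σ k) <;> simp [hx]
  simp only [e3]
  rw [integral_indicator (hωm _), Measure.restrict_restrict (hωm _),
    Set.inter_eq_self_of_subset_left (hωΩ _)]

end Polarization

/-! ### The polarization tensor -/

section Polarization
variable {N : ℕ} {Ω : Set (EuclideanSpace ℝ (Fin N))} {γ₀ γ₁ : ℝ}
  {ω : ℕ → Set (EuclideanSpace ℝ (Fin N))} {θ : EuclideanSpace ℝ (Fin N) → ℝ}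
  {B : EuclideanSpace ℝ (Fin N) → Matrix (Fin N) (Fin N) ℝ}
  {μ : Measure (EuclideanSpace ℝ (Fin N))}
  {M : EuclideanSpace ℝ (Fin N) → Matrix (Fin N) (Fin N) ℝ}

/-- On `ω n` the jump `γ_n - γ₀` is `γ₁ - γ₀`, and it vanishes elsewhere. -/
theorem setIntegral_inner_eq_flux (hΩb : Bornology.IsBounded Ω) (h₀ : 0 < γ₀) (h₁ : 0 < γ₁)
    {s : Set (EuclideanSpace ℝ (Fin N))} (hs : MeasurableSet s) (hsΩ : s ⊆ Ω)
    {X : EuclideanSpace ℝ (Fin N) → EuclideanSpace ℝ (Fin N)} (hX : MemLp X 2 (volume.restrict Ω))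
    (ξ : EuclideanSpace ℝ (Fin N)) {φ : EuclideanSpace ℝ (Fin N) → ℝ} (hφ : IsTestFunction Ω φ) :
    (γ₁ - γ₀) * ∫ x in s, inner ℝ (X x) ξ * φ x =
      (∫ x in Ω, φ x * inner ℝ (flux (twoPhase γ₀ γ₁ s) X x) ξ) -
        γ₀ * ∫ x in Ω, φ x * inner ℝ (X x) ξ := by
  have hξ := memLp_const_of_isBounded hΩb ξ
  have hs' : s = s ∩ Ω := (Set.inter_eq_self_of_subset_left hsΩ).symm
  rw [hs', ← Measure.restrict_restrict hs, ← hs', ← integral_indicator hs, ← integral_const_mul,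
    ← integral_const_mul, ← integral_sub
      (hφ.integrable_mul (integrable_inner_of_memLp (memLp_flux_twoPhase h₀ h₁ hs hX) hξ))
      ((hφ.integrable_mul (integrable_inner_of_memLp hX hξ)).const_mul _)]
  congr 1
  ext x
  rw [flux_twoPhase, real_inner_smul_left]
  by_cases hx : x ∈ s
  · rw [Set.indicator_of_mem hx, phase_of_mem hx]
    ring
  · rw [Set.indicator_of_notMem hx, phase_of_notMem hx]
    ring

/-- The polarization tensor is determined by the homogenized one:
`(γ₁ - γ₀) θ ⟨M ξ, ξ⟩ = ⟨B ξ, ξ⟩ - γ₀ |ξ|²`. -/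
theorem ae_polarization_eq [NeZero N] (hΩ : IsOpen Ω) (hΩb : Bornology.IsBounded Ω)
    (h₀ : 0 < γ₀) (h₁ : 0 < γ₁) (hωm : ∀ n, MeasurableSet (ω n)) (hωΩ : ∀ n, ω n ⊆ Ω)
    {δ : ℝ} (hδ : 0 < δ) (hωδ : Tendsto (fun n => volume.real (ω n)) atTop (𝓝 δ))
    (hθ : IsVolumeFraction Ω ω θ)
    (hB : IsConductivity (min γ₀ γ₁) (max γ₀ γ₁) Ω B)
    (hH : HConverges Ω (fun n => twoPhase γ₀ γ₁ (ω n)) B)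
    [IsFiniteMeasure μ]
    (hμ : μ = (volume.restrict Ω).withDensity fun x => ENNReal.ofReal (δ⁻¹ * θ x))
    (hM : ∀ i j, MemLp (fun x => M x i j) 2 μ)
    {z : ℕ → EuclideanSpace ℝ (Fin N) → ℝ}
    {W : ℕ → Fin N → EuclideanSpace ℝ (Fin N) → EuclideanSpace ℝ (Fin N)}
    {ξ : EuclideanSpace ℝ (Fin N)}
    (h : ∀ n, IsCorrectorAlong Ω (twoPhase γ₀ γ₁ (ω n)) B ξ (z n) (fun x => ∑ i, ξ i • W n i x))
    (hW : ∀ n i, MemLp (W n i) 2 (volume.restrict Ω))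
    {σ : ℕ → ℕ} (hσ : StrictMono σ)
    (hlim : ∀ i j, WeakStarTendsto (fun k => ω (σ k)) (fun k x => W (σ k) i x j)
      (fun x => M x i j) μ) :
    ∀ᵐ x ∂(volume.restrict Ω), (γ₁ - γ₀) * (θ x * ∑ i, ∑ j, M x i j * ξ i * ξ j) =
      inner ℝ (flux B (fun _ => ξ) x) ξ - γ₀ * ‖ξ‖ ^ 2 := by
  have hfin := isFiniteMeasure_restrict_of_isBounded hΩb
  have hBi := hB.integrable_inner_flux hΩb h₀ h₁ ξ ξ
  have hMi : ∀ i j, Integrable (fun x => M x i j) μ := fun i j => (hM i j).integrable (by norm_num)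
  have hq : Integrable (fun x => ∑ i, ∑ j, M x i j * ξ i * ξ j) μ :=
    integrable_finsetSum _ fun i _ => integrable_finsetSum _ fun j _ =>
      ((hMi i j).mul_const _).mul_const _
  have hθq : Integrable (fun x => θ x * ∑ i, ∑ j, M x i j * ξ i * ξ j) (volume.restrict Ω) := by
    rw [hμ, integrable_withDensity_iff_integrable_smul₀' (hθ.aemeasurable_density δ)
      (ae_of_all _ fun _ => ENNReal.ofReal_lt_top)] at hq
    refine (hq.const_mul δ).congr ?_
    filter_upwards [hθ.2.1] with x hx
    rw [ENNReal.toReal_ofReal (mul_nonneg (inv_nonneg.2 hδ.le) hx.1), smul_eq_mul]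
    field_simp
  -- The two limits of `|ω n|⁻¹ ∫_(ω n) ⟨X n, ξ⟩ φ` for test functions `φ`.
  have key : ∀ φ, IsTestFunction Ω φ →
      (γ₁ - γ₀) * (∫ x in Ω, φ x * (θ x * ∑ i, ∑ j, M x i j * ξ i * ξ j)) =
        (∫ x in Ω, φ x * inner ℝ (flux B (fun _ => ξ) x) ξ) -
          γ₀ * ∫ x in Ω, φ x * ‖ξ‖ ^ 2 := by
    intro φ hφ
    obtain ⟨K, -, hK⟩ := hφ.exists_bound
    have e1 := tendsto_finsetSum Finset.univ fun i _ => tendsto_finsetSum Finset.univ fun j _ =>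
      (hlim i j φ hφ.1.continuous).const_mul (ξ i * ξ j)
    have e2 : ∑ i, ∑ j, ξ i * ξ j * ∫ x, M x i j * φ x ∂μ =
        δ⁻¹ * ∫ x in Ω, φ x * (θ x * ∑ i, ∑ j, M x i j * ξ i * ξ j) := by
      have hMφ : ∀ i j, Integrable (fun x => ξ i * ξ j * (M x i j * φ x)) μ := fun i j =>
        ((hMi i j).mul_bdd hφ.1.continuous.aestronglyMeasurable (ae_of_all _ hK)).const_mul _
      simp only [← integral_const_mul (ξ _ * ξ _)]
      simp only [← integral_finsetSum Finset.univ fun j _ => hMφ _ j]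
      rw [← integral_finsetSum Finset.univ fun i _ =>
        integrable_finsetSum Finset.univ fun j _ => hMφ i j, hμ, hθ.integral_withDensity hδ]
      congr 2
      ext x
      simp only [Finset.mul_sum]
      refine Finset.sum_congr rfl fun i _ => Finset.sum_congr rfl fun j _ => ?_
      ring
    have e3 : ∀ k, ∑ i, ∑ j, ξ i * ξ j *
        ((volume.real (ω (σ k)))⁻¹ * ∫ x in ω (σ k), W (σ k) i x j * φ x) =
        (volume.real (ω (σ k)))⁻¹ *
          ∫ x in ω (σ k), inner ℝ (∑ i, ξ i • W (σ k) i x) ξ * φ x := fun k => by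
      have hWφ : ∀ i j, Integrable (fun x => ξ i * ξ j * (W (σ k) i x j * φ x))
          (volume.restrict (ω (σ k))) := fun i j => by
        have e4 : Integrable (fun x => W (σ k) i x j) (volume.restrict Ω) := by
          have := integrable_inner_of_memLp (hW (σ k) i)
            (memLp_const_of_isBounded hΩb (EuclideanSpace.single j (1 : ℝ)))
          simpa [EuclideanSpace.inner_single_right] using this
        exact ((e4.mono_measure (Measure.restrict_mono_set _ (hωΩ _))).mul_bdd
          hφ.1.continuous.aestronglyMeasurable (ae_of_all _ hK)).const_mul _
      simp only [mul_left_comm (ξ _ * ξ _), ← Finset.mul_sum]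
      congr 1
      simp only [← integral_const_mul (ξ _ * ξ _)]
      simp only [← integral_finsetSum Finset.univ fun j _ => hWφ _ j]
      rw [← integral_finsetSum Finset.univ fun i _ =>
        integrable_finsetSum Finset.univ fun j _ => hWφ i j]
      congr 1
      ext x
      simp only [sum_inner, PiLp.inner_apply, Finset.sum_mul, RCLike.inner_apply, conj_trivial,
        PiLp.smul_apply, smul_eq_mul]
      refine Finset.sum_congr rfl fun i _ => Finset.sum_congr rfl fun j _ => ?_
      ring
    rw [e2] at e1
    simp only [e3] at e1
    have hXw := IsCorrectorAlong.weakTendstoL2_const hΩb h₀ h₁ hωm hB hH h (fun x => φ x • ξ)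
      (memLp_smul_of_norm_le (hφ.memLp 2 Ω) aestronglyMeasurable_const (fun _ => le_rfl))
    simp only [real_inner_smul_right, real_inner_self_eq_norm_sq] at hXw
    have e5 := (IsCorrectorAlong.tendsto_integral_flux hΩ hΩb h₀ h₁ hωm hB hH h hφ ξ).sub
      (hXw.const_mul γ₀)
    have e6 := ((hωδ.inv₀ hδ.ne').mul e5).comp hσ.tendsto_atTop
    have e7 := e1.const_mul (γ₁ - γ₀)
    have e8 := tendsto_nhds_unique e7 (e6.congr fun k => by
      simp only [Function.comp_apply]
      rw [← setIntegral_inner_eq_flux hΩb h₀ h₁ (hωm _) (hωΩ _) ((h _).memLp hΩb) ξ hφ]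
      ring)
    rw [mul_left_comm] at e8
    exact mul_left_cancel₀ (inv_ne_zero hδ.ne') e8
  have hf : Integrable (fun x => (γ₁ - γ₀) * (θ x * ∑ i, ∑ j, M x i j * ξ i * ξ j) -
      (inner ℝ (flux B (fun _ => ξ) x) ξ - γ₀ * ‖ξ‖ ^ 2)) (volume.restrict Ω) :=
    (hθq.const_mul _).sub (hBi.sub (integrable_const _))
  have hzero := hΩ.ae_eq_zero_of_integral_contDiff_smul_eq_zero (μ := volume)
    (IntegrableOn.locallyIntegrableOn hf) (fun φ h1 h2 h3 => by
      have hφ : IsTestFunction Ω φ := ⟨h1, h2, h3⟩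
      have e1 := key φ hφ
      have i1 := (hφ.integrable_mul hθq).const_mul (γ₁ - γ₀)
      have i2 := hφ.integrable_mul hBi
      have i3 := (hφ.integrable_mul (integrable_const (‖ξ‖ ^ 2))).const_mul γ₀
      have i4 : Integrable (fun x => φ x * inner ℝ (flux B (fun _ => ξ) x) ξ -
          γ₀ * (φ x * ‖ξ‖ ^ 2)) (volume.restrict Ω) := i2.sub i3
      rw [← integral_const_mul, ← integral_const_mul, ← integral_sub i2 i3, ← sub_eq_zero,
        ← integral_sub i1 i4] at e1
      rw [← setIntegral_eq_integral_of_forall_compl_eq_zero (s := Ω)]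
      · rw [← e1]
        congr 1
        ext x
        simp only [smul_eq_mul]
        ring
      · intro x hx
        rw [image_eq_zero_of_notMem_tsupport (fun hx' => hx (h3 hx')), zero_smul])
  rw [← ae_restrict_iff' hΩ.measurableSet] at hzero
  filter_upwards [hzero] with x hx
  linarith

/-- The pointwise algebra: `r = |ξ|²`, `b = ⟨B ξ, ξ⟩` and `q = ⟨M ξ, ξ⟩`. -/
theorem polarization_bounds_of_mean_bounds (h₀ : 0 < γ₀) (h₁ : 0 < γ₁) (hγ : γ₀ ≠ γ₁)
    {t b q r : ℝ} (ht0 : 0 < t) (ht1 : t ≤ 1) (hr : 0 ≤ r)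
    (hq : (γ₁ - γ₀) * (t * q) = b - γ₀ * r) (hu : b ≤ (γ₁ * t + γ₀ * (1 - t)) * r)
    (hl : r ≤ (γ₁⁻¹ * t + γ₀⁻¹ * (1 - t)) * b) :
    min 1 (γ₀ / (t * γ₀ + (1 - t) * γ₁)) * r ≤ q ∧
      q ≤ max 1 (γ₀ / (t * γ₀ + (1 - t) * γ₁)) * r := by
  have hD : 0 < t * γ₀ + (1 - t) * γ₁ := by
    have : 0 ≤ (1 - t) * γ₁ := mul_nonneg (by linarith) h₁.le
    have := mul_pos ht0 h₀
    linarith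
  set D := t * γ₀ + (1 - t) * γ₁ with hDdef
  have hl' : γ₀ * γ₁ * r ≤ D * b := by
    have := mul_le_mul_of_nonneg_left hl (mul_pos h₀ h₁).le
    have e : γ₀ * γ₁ * ((γ₁⁻¹ * t + γ₀⁻¹ * (1 - t)) * b) = D * b := by
      rw [hDdef]
      field_simp
    linarith
  have hu' : t * ((γ₁ - γ₀) * q) ≤ t * ((γ₁ - γ₀) * r) := by nlinarith
  have hl'' : t * ((γ₁ - γ₀) * (γ₀ * r)) ≤ t * ((γ₁ - γ₀) * (D * q)) := by
    have e1 : t * ((γ₁ - γ₀) * (D * q)) = D * (b - γ₀ * r) := by rw [← hq]; ring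
    have e2 : t * ((γ₁ - γ₀) * (γ₀ * r)) = γ₀ * γ₁ * r - D * (γ₀ * r) := by rw [hDdef]; ring
    rw [e1, e2]
    linarith
  have hu2 := le_of_mul_le_mul_left hu' ht0
  have hl2 := le_of_mul_le_mul_left hl'' ht0
  have hκ : γ₀ / D * r = γ₀ * r / D := by ring
  rcases lt_or_gt_of_ne hγ with hlt | hgt
  · have hpos : 0 < γ₁ - γ₀ := by linarith
    have h3 := le_of_mul_le_mul_left hu2 hpos
    have h4 := le_of_mul_le_mul_left hl2 hpos
    have h5 : γ₀ / D * r ≤ q := by rw [hκ, div_le_iff₀ hD]; linarith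
    exact ⟨(mul_le_mul_of_nonneg_right (min_le_right _ _) hr).trans h5,
      h3.trans (le_mul_of_one_le_left hr (le_max_left _ _))⟩
  · have hneg : γ₁ - γ₀ < 0 := by linarith
    have h3 := (mul_le_mul_left_of_neg hneg).1 hu2
    have h4 := (mul_le_mul_left_of_neg hneg).1 hl2
    have h5 : q ≤ γ₀ / D * r := by rw [hκ, le_div_iff₀ hD]; linarith
    exact ⟨(mul_le_of_le_one_left hr (min_le_left _ _)).trans h3,
      h5.trans (mul_le_mul_of_nonneg_right (le_max_right _ _) hr)⟩

end Polarization

theorem proposition2p4 {N : ℕ} (Ω : Set (EuclideanSpace ℝ (Fin N)))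
    (hΩ : IsOpen Ω) (hΩb : Bornology.IsBounded Ω)
    (γ₀ γ₁ : ℝ) (hγ₀ : 0 < γ₀) (hγ₁ : 0 < γ₁) (hγ : γ₀ ≠ γ₁)
    (ω : ℕ → Set (EuclideanSpace ℝ (Fin N)))
    (hωm : ∀ n, MeasurableSet (ω n)) (hωΩ : ∀ n, ω n ⊆ Ω)
    (d₀ : ℝ) (hd₀ : 0 < d₀) (hωd : ∀ n, ∀ x ∈ ω n, ∀ y ∈ frontier Ω, d₀ ≤ dist x y)
    (δ : ℝ) (hδ : 0 < δ) (hωδ : Tendsto (fun n => volume.real (ω n)) atTop (𝓝 δ))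
    (θ : EuclideanSpace ℝ (Fin N) → ℝ) (hθ : IsVolumeFraction Ω ω θ)
    (γstar : EuclideanSpace ℝ (Fin N) → Matrix (Fin N) (Fin N) ℝ)
    (hγstar : IsConductivity (min γ₀ γ₁) (max γ₀ γ₁) Ω γstar)
    (hH : HConverges Ω (fun n => twoPhase γ₀ γ₁ (ω n)) γstar)
    (μ : Measure (EuclideanSpace ℝ (Fin N)))
    (M : EuclideanSpace ℝ (Fin N) → Matrix (Fin N) (Fin N) ℝ)
    (hM : IsPolarizationTensor Ω γ₀ γ₁ ω γstar μ M) :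
    ∀ᵐ x ∂μ, ∀ ξ : EuclideanSpace ℝ (Fin N),
      min 1 (γ₀ / (θ x * γ₀ + (1 - θ x) * γ₁)) * ‖ξ‖ ^ 2 ≤ ∑ i, ∑ j, M x i j * ξ i * ξ j ∧
      ∑ i, ∑ j, M x i j * ξ i * ξ j ≤
        max 1 (γ₀ / (θ x * γ₀ + (1 - θ x) * γ₁)) * ‖ξ‖ ^ 2 := by
  -- The Poincaré inequality fails for `N = 0`, where both sides of the claim vanish.
  rcases Nat.eq_zero_or_pos N with rfl | hN
  · refine ae_of_all _ fun x ξ => ?_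
    simp [Subsingleton.elim ξ 0]
  have : NeZero N := ⟨hN.ne'⟩
  obtain ⟨hμfin, -, hM2, w, W, σ, hw, hσ, hμlim, hlim⟩ := hM
  have hμ := measure_eq_withDensity hΩb hωm hωΩ hδ hωδ hθ hσ hμlim
  have hcorr : ∀ ξ n, IsCorrectorAlong Ω (twoPhase γ₀ γ₁ (ω n)) γstar ξ
      (fun x => ∑ i, ξ i * (w n i x - x i)) (fun x => ∑ i, ξ i • W n i x) := fun ξ n =>
    (hw n).along (fun _ hG => memLp_flux_twoPhase hγ₀ hγ₁ (hωm n) hG)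
      (fun _ hG => hγstar.memLp_flux (lt_min hγ₀ hγ₁).le hG) hΩb ξ
  have hW : ∀ n i, MemLp (W n i) 2 (volume.restrict Ω) := fun n i => by
    refine ((hw n i).1.2.1.add (memLp_const_of_isBounded hΩb (EuclideanSpace.single i 1))).ae_eq
      (ae_of_all _ fun x => ?_)
    simp
  -- It suffices to consider a countable dense set of directions.
  have hae : ∀ᵐ x ∂(volume.restrict Ω), 0 < θ x → ∀ k : ℕ,
      min 1 (γ₀ / (θ x * γ₀ + (1 - θ x) * γ₁)) *
        ‖TopologicalSpace.denseSeq (EuclideanSpace ℝ (Fin N)) k‖ ^ 2 ≤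
        ∑ i, ∑ j, M x i j * TopologicalSpace.denseSeq (EuclideanSpace ℝ (Fin N)) k i *
          TopologicalSpace.denseSeq (EuclideanSpace ℝ (Fin N)) k j ∧
      ∑ i, ∑ j, M x i j * TopologicalSpace.denseSeq (EuclideanSpace ℝ (Fin N)) k i *
          TopologicalSpace.denseSeq (EuclideanSpace ℝ (Fin N)) k j ≤
        max 1 (γ₀ / (θ x * γ₀ + (1 - θ x) * γ₁)) *
          ‖TopologicalSpace.denseSeq (EuclideanSpace ℝ (Fin N)) k‖ ^ 2 := by
    have h1 := ae_all_iff.2 fun k : ℕ => ae_polarization_eq hΩ hΩb hγ₀ hγ₁ hωm hωΩ hδ hωδ hθ hγstar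
      hH hμ hM2 (hcorr (TopologicalSpace.denseSeq (EuclideanSpace ℝ (Fin N)) k)) hW hσ hlim
    have h2 := ae_all_iff.2 fun k : ℕ => IsCorrectorAlong.ae_le_arithmetic hΩ hΩb hγ₀ hγ₁ hωm hθ
      hγstar hH (hcorr (TopologicalSpace.denseSeq (EuclideanSpace ℝ (Fin N)) k))
    have h3 := ae_all_iff.2 fun k : ℕ => ae_all_iff.2 fun t : ℚ =>
      IsCorrectorAlong.ae_nonneg_quadratic hΩ hΩb hγ₀ hγ₁ hωm hθ
      hγstar hH (hcorr (TopologicalSpace.denseSeq (EuclideanSpace ℝ (Fin N)) k)) t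
    filter_upwards [h1, h2, h3, hθ.2.1] with x hx1 hx2 hx3 hx4 hpos k
    have hm : 0 < γ₁⁻¹ * θ x + γ₀⁻¹ * (1 - θ x) := by
      have e1 := mul_pos (inv_pos.2 hγ₁) hpos
      have e2 := mul_nonneg (inv_pos.2 hγ₀).le (sub_nonneg.2 hx4.2)
      linarith
    exact polarization_bounds_of_mean_bounds hγ₀ hγ₁ hγ hpos hx4.2 (sq_nonneg _) (hx1 k) (hx2 k)
      (le_mul_of_quadratic_nonneg hm (hx3 k))
  rw [hμ, ae_withDensity_iff' (hθ.aemeasurable_density δ)]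
  filter_upwards [hae] with x hx hx0 ξ
  have hpos : 0 < θ x := by
    by_contra hneg
    exact hx0 (ENNReal.ofReal_of_nonpos
      (mul_nonpos_of_nonneg_of_nonpos (inv_nonneg.2 hδ.le) (not_lt.1 hneg)))
  have hcont : ∀ i : Fin N, Continuous fun ξ : EuclideanSpace ℝ (Fin N) => ξ i :=
    fun i => (EuclideanSpace.proj (𝕜 := ℝ) i).continuous
  refine (TopologicalSpace.denseRange_denseSeq (EuclideanSpace ℝ (Fin N))).induction_on
    (p := fun ξ : EuclideanSpace ℝ (Fin N) => min 1 (γ₀ / (θ x * γ₀ + (1 - θ x) * γ₁)) * ‖ξ‖ ^ 2 ≤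
      ∑ i, ∑ j, M x i j * ξ i * ξ j ∧ ∑ i, ∑ j, M x i j * ξ i * ξ j ≤
        max 1 (γ₀ / (θ x * γ₀ + (1 - θ x) * γ₁)) * ‖ξ‖ ^ 2) ξ ?_ (hx hpos)
  have hq : Continuous fun ξ : EuclideanSpace ℝ (Fin N) => ∑ i, ∑ j, M x i j * ξ i * ξ j :=
    continuous_finsetSum _ fun i _ => continuous_finsetSum _ fun j _ =>
      (continuous_const.mul (hcont i)).mul (hcont j)
  exact (isClosed_le (by fun_prop) hq).inter (isClosed_le hq (by fun_prop))
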